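/- **Setting (one-clock guarded type theory, read in its standard model, the topos of trees).** An object $X$ of the topos of trees is a sequence of sets $X(0)\leftarrow X(1)\leftarrow X(2)\leftarrow\cdots$ with restriction maps $r_n:X(n+1)\to X(n)$; a morphism is a family of maps commuting with the restrictions. Put $(\triangleright X)(0)=1$, $(\triangleright X)(n+1)=X(n)$; $\operatorname{next}:X\to\triangleright X$ is given by the restriction maps, $\circledast:\triangleright(X\to Y)\times\triangleright X\to\triangleright Y$ is the componentwise application, and every morphism $f:\triangleright A\to A$ (in any context) has a unique guarded fixed point $\operatorname{fix} f=f(\operatorname{next}(\operatorname{fix} f))$. $U$ is the universe of small objects ($U(n)$ is the class of small sequences truncated to stages $\le n$), with the code $\widehat{\triangleright}:\triangleright U\to U$ of $\triangleright$. $LA$ is the solution of $LA\cong A+\triangleright LA$, with $\eta:A\to LA$ and $\theta:\triangleright LA\to LA$. A type is inhabited when it has a global element, and $A$ iff $B$ means that there are morphisms $A\to B$ and $B\to A$. **FPC.** Types are $\tau::=\alpha\mid 1\mid\tau+\tau\mid\tau\times\tau\mid\tau\to\tau\mid\mu\alpha.\tau$, and terms are $$L,M,N::=\langle\rangle\mid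 x\mid\mathsf{inl}\,M\mid\mathsf{inr}\,M\mid\mathsf{case}\,L\,\mathsf{of}\,x_1.M;x_2.N\mid\langle M,N\rangle\mid\mathsf{fst}\,M\mid\mathsf{snd}\,M\mid\lambda x{:}\tau.M\mid MN\mid\mathsf{fold}\,M\mid\mathsf{unfold}\,M ,$$ with the usual typing rules for $\Gamma\vdash M:\sigma$, where all types in $\Gamma$ and $\sigma$ are closed; $\mathsf{fold}$ and $\mathsf{unfold}$ go between $\tau[\mu\alpha.\tau/\alpha]$ and $\mu\alpha.\tau$. The call-by-name small-step relation $M\to^k N$ on closed terms ($k\in\{0,1\}$) is the closure, under the evaluation contexts $E::=[\cdot]\mid E\,M\mid\mathsf{case}\,E\,\mathsf{of}\,x_1.M;x_2.N\mid\mathsf{fst}\,E\mid\mathsf{snd}\,E\mid\mathsf{unfold}\,E$, of $\mathsf{unfold}(\mathsf{fold}\,M)\to^1 M$ and of the usual reductions $\to^0$ of an application of a $\lambda$, a $\mathsf{case}$ of $\mathsf{inl}$ or $\mathsf{inr}$, and a projection of a pair. $M\to_*^k N$ is its reflexive transitive closure with $k$ counting the $\to^1$ steps. The *guarded transitive closure*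 is the type $M\Rightarrow^k N$ given by $$M\Rightarrow^0N:=M\to_*^0N,\qquad M\Rightarrow^{k+1}N:=\Sigma M',M''.\ (M\to_*^0M')\times(M'\to^1M'')\times\triangleright(M''\Rightarrow^kN).$$ **Denotational semantics.** A type with variables in $\Theta$ denotes a morphism $U^{|\Theta|}\to U$: $\llbracket\alpha\rrbracket(\rho)=\rho(\alpha)$, $\llbracket1\rrbracket(\rho)=L1$, $\llbracket\sigma\times\tau\rrbracket(\rho)=\llbracket\sigma\rrbracket(\rho)\times\llbracket\tau\rrbracket(\rho)$, $\llbracket\sigma+\tau\rrbracket(\rho)=L(\llbracket\sigma\rrbracket(\rho)+\llbracket\tau\rrbracket(\rho))$, $\llbracket\sigma\to\tau\rrbracket(\rho)=\llbracket\sigma\rrbracket(\rho)\to\llbracket\tau\rrbracket(\rho)$, and, by guarded recursion, $\llbracket\mu\alpha.\tau\rrbracket(\rho)=\triangleright\big(\llbracket\tau\rrbracket(\rho,\llbracket\mu\alpha.\tau\rrbracket(\rho))\big)$; for closed $\mu\alpha.\tau$ this equals $\triangleright\llbracket\tau[\mu\alpha.\tau/\alpha]\rrbracket$. Every closed type $\sigma$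 carries $\theta_\sigma:\triangleright\llbracket\sigma\rrbracket\to\llbracket\sigma\rrbracket$, defined by guarded recursion and induction on $\sigma$: $\theta$ of $L$ for $1$ and for sums, componentwise for products, $\theta_{\sigma\to\tau}(f)(x)=\theta_\tau(f\circledast\operatorname{next}x)$, and $\theta_{\mu\alpha.\tau}(x)=\operatorname{next}(\theta_{\tau[\mu\alpha.\tau/\alpha]})\circledast x$. Put $\delta_\sigma=\theta_\sigma\circ\operatorname{next}$. A derivation of $\Gamma\vdash M:\sigma$ denotes a morphism $\llbracket M\rrbracket:\llbracket\Gamma\rrbracket\to\llbracket\sigma\rrbracket$, where $\llbracket\Gamma\rrbracket$ is the product of the denotations of the types in $\Gamma$: variables, pairs, projections, abstraction and application are interpreted by the cartesian closed structure, $\llbracket\langle\rangle\rrbracket(\gamma)=\eta(*)$, $\llbracket\mathsf{inl}\,M\rrbracket(\gamma)=\eta(\mathrm{inl}\,\llbracket M\rrbracket(\gamma))$, $\llbracket\mathsf{inr}\,M\rrbracket(\gamma)=\eta(\mathrm{inr}\,\llbracket M\rrbracket(\gamma))$, $\llbracket\mathsf{fold}\,M\rrbracket(\gamma)=\operatorname{next}(\llbracket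 M\rrbracket(\gamma))$, $\llbracket\mathsf{unfold}\,M\rrbracket(\gamma)=\theta_{\tau[\mu\alpha.\tau/\alpha]}(\llbracket M\rrbracket(\gamma))$, and $\llbracket\mathsf{case}\,L\,\mathsf{of}\,x_1.M;x_2.N\rrbracket(\gamma)=\widehat f(\llbracket L\rrbracket(\gamma))$, where $f(\mathrm{inl}\,x)=\llbracket M\rrbracket(\gamma,x)$, $f(\mathrm{inr}\,x)=\llbracket N\rrbracket(\gamma,x)$, and $\widehat f$ is the extension of $f$ to a homomorphism of $\triangleright$-algebras: $\widehat f(\eta(a))=f(a)$, $\widehat f(\theta(r))=\theta_\sigma(\operatorname{next}(\widehat f)\circledast r)$. **Theorem (Intensional Computational Adequacy).** Let $M$ be a closed FPC term with $\vdash M:1$ and let $k$ be a natural number. Then $$M\Rightarrow^k\langle\rangle\quad\text{iff}\quad\llbracket M\rrbracket(*)=\delta_1^k(\eta(*)).$$ That is, in the topos of trees there is a morphism from the type $M\Rightarrow^k\langle\rangle$ to the identity type $\llbracket M\rrbracket(*)=_{\llbracket1\rrbracket}\delta_1^k(\eta(*))$, and there is a morphism in the opposite direction. In particular, at every stage $n$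 the first is inhabited if and only if the equality holds. -/

import Mathlib

/-!
# The topos of trees, the language FPC, and its guarded denotational semantics

Guarded dependent type theory with one clock is read in its standard model, the topos of trees:
a closed type is an object of the topos of trees, a term in context is a morphism, the universe is
the universe of (codes of) small objects, and "later", `next`, guarded fixed points, identity types,
dependent sums and function types have their usual meaning there.
Stages are numbered from `0`.
-/

universe u v w

/-! ## Objects and morphisms of the topos of trees -/

/-- An object of the topos of trees: sets `obj n` with restriction maps `obj (n+1) → obj n`. -/
structure ToT : Type (u + 1) where
  obj : ℕ → Type u
  res : ∀ n, obj (n + 1) → obj n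

namespace ToT

/-- A morphism of the topos of trees: a family of maps commuting with the restrictions. -/
@[ext]
structure Hom (X : ToT.{u}) (Y : ToT.{v}) where
  app : ∀ n, X.obj n → Y.obj n
  naturality : ∀ n x, Y.res n (app (n + 1) x) = app n (X.res n x)

/-- The restriction `X(n) → X(j)` for `j ≤ n`, composed from the one-step restrictions. -/
def down (X : ToT.{u}) {j n : ℕ} (h : j ≤ n) : X.obj n → X.obj j :=
  Nat.leRec (motive := fun n _ => X.obj n → X.obj j) id (fun n _ f x => f (X.res n x)) h

theorem down_self (X : ToT.{u}) {n : ℕ} (h : n ≤ n) (x : X.obj n) : X.down h x = x := by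
  unfold down
  rw [Nat.leRec_self]
  rfl

theorem down_succ (X : ToT.{u}) {j n : ℕ} (h : j ≤ n) (h' : j ≤ n + 1) (x : X.obj (n + 1)) :
    X.down h' x = X.down h (X.res n x) := by
  unfold down
  rw [Nat.leRec_succ _ _ h]

theorem res_down (X : ToT.{u}) {j n : ℕ} (h : j + 1 ≤ n) (h' : j ≤ n) (x : X.obj n) :
    X.res j (X.down h x) = X.down h' x := by
  induction n with
  | zero => omega
  | succ n ih =>
    rcases Nat.lt_or_ge j n with hj | hj
    · rw [X.down_succ hj h, X.down_succ hj.le h', ih hj hj.le]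
    · obtain rfl : n = j := by omega
      rw [X.down_self, X.down_succ le_rfl, X.down_self]

/-- The constant object on a set. -/
def const (A : Type u) : ToT.{u} := ⟨fun _ => A, fun _ a => a⟩

/-- The terminal object `1`. -/
def one : ToT.{u} := const PUnit

/-- The binary product. -/
def prod (X : ToT.{u}) (Y : ToT.{v}) : ToT.{max u v} :=
  ⟨fun n => X.obj n × Y.obj n, fun n p => (X.res n p.1, Y.res n p.2)⟩

/-- The binary coproduct. -/
def sum (X : ToT.{u}) (Y : ToT.{v}) : ToT.{max u v} :=
  ⟨fun n => X.obj n ⊕ Y.obj n, fun n => Sum.map (X.res n) (Y.res n)⟩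

/-- The product of a family indexed by a (constant) set. -/
def pi {I : Type v} (X : I → ToT.{u}) : ToT.{max u v} :=
  ⟨fun n => ∀ i, (X i).obj n, fun n x i => (X i).res n (x i)⟩

/-- The dependent sum of a family indexed by a (constant) set. -/
def sigma {I : Type v} (X : I → ToT.{u}) : ToT.{max u v} :=
  ⟨fun n => Σ i, (X i).obj n, fun n x => ⟨x.1, (X x.1).res n x.2⟩⟩

/-- The exponential: at stage `n`, families of maps at the stages `j ≤ n` that commute with the
restrictions. -/
def exp (X : ToT.{u}) (Y : ToT.{v}) : ToT.{max u v} where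
  obj n := {f : ∀ j, j ≤ n → X.obj j → Y.obj j //
    ∀ j (h : j + 1 ≤ n) x, Y.res j (f (j + 1) h x) = f j (Nat.le_of_succ_le h) (X.res j x)}
  res n f := ⟨fun j h => f.1 j (h.trans n.le_succ), fun j h => f.2 j (h.trans n.le_succ)⟩

/-- `▷X` at stage `n`: a point at the first stage, `X(n-1)` afterwards. -/
def laterObj (X : ToT.{u}) : ℕ → Type u
  | 0 => PUnit
  | n + 1 => X.obj n

/-- The "later" operator `▷`. -/
def later (X : ToT.{u}) : ToT.{u} where
  obj := X.laterObj
  res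
    | 0 => fun _ => PUnit.unit
    | n + 1 => X.res n

/-- `LA` at stage `n`, the disjoint union of `A(0), …, A(n)` and a point, presented as
`A(n) + (▷LA)(n)`. -/
def liftObj (A : ToT.{u}) : ℕ → Type u
  | 0 => A.obj 0 ⊕ PUnit
  | n + 1 => A.obj (n + 1) ⊕ liftObj A n

/-- The restriction maps of `LA`. -/
def liftRes (A : ToT.{u}) : ∀ n, liftObj A (n + 1) → liftObj A n
  | 0 => Sum.map (A.res 0) (fun _ => PUnit.unit)
  | n + 1 => Sum.map (A.res (n + 1)) (liftRes A n)

/-- The guarded lifting `LA`, the solution of `LA ≅ A + ▷LA`. -/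
def lift (A : ToT.{u}) : ToT.{u} := ⟨liftObj A, liftRes A⟩

/-- The identity type of two global elements, as a (non-standard) truth value. -/
def Id {X : ToT.{u}} (x y : Hom one.{u} X) : ToT.{0} where
  obj n := PLift (x.app n PUnit.unit = y.app n PUnit.unit)
  res n p := ⟨(x.naturality n _).symm.trans ((congrArg (X.res n) p.down).trans (y.naturality n _))⟩

/-! ## Morphisms that interpret the term formers -/

namespace Hom

variable {X : ToT.{u}} {Y : ToT.{v}} {Z : ToT.{w}}

def id (X : ToT.{u}) : Hom X X := ⟨fun _ x => x, fun _ _ => rfl⟩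

/-- Composition, in diagrammatic order. -/
def comp (f : Hom X Y) (g : Hom Y Z) : Hom X Z :=
  ⟨fun n x => g.app n (f.app n x), fun n x => by rw [g.naturality, f.naturality]⟩

/-- The identity map between equal objects. -/
def ofEq {X Y : ToT.{u}} (h : X = Y) : Hom X Y := h ▸ Hom.id X

/-- The `k`-fold iterate of an endomorphism. -/
def iterate (f : Hom X X) : ℕ → Hom X X
  | 0 => Hom.id X
  | k + 1 => (iterate f k).comp f

/-- The unique map to the terminal object. -/
def toOne (X : ToT.{u}) : Hom X one.{v} := ⟨fun _ _ => PUnit.unit, fun _ _ => rfl⟩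

def fst : Hom (prod X Y) X := ⟨fun _ p => p.1, fun _ _ => rfl⟩

def snd : Hom (prod X Y) Y := ⟨fun _ p => p.2, fun _ _ => rfl⟩

def pair (f : Hom X Y) (g : Hom X Z) : Hom X (prod Y Z) :=
  ⟨fun n x => (f.app n x, g.app n x),
    fun n x => Prod.ext (f.naturality n x) (g.naturality n x)⟩

def inl : Hom X (sum X Y) := ⟨fun _ x => Sum.inl x, fun _ _ => rfl⟩

def inr : Hom Y (sum X Y) := ⟨fun _ y => Sum.inr y, fun _ _ => rfl⟩

/-- Case distinction in a context `G`. -/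
def copair {G : ToT.{u}} {A B : ToT.{v}} {C : ToT.{w}}
    (f : Hom (prod G A) C) (g : Hom (prod G B) C) : Hom (prod G (sum A B)) C where
  app n p := Sum.elim (fun a => f.app n (p.1, a)) (fun b => g.app n (p.1, b)) p.2
  naturality n p := by
    obtain ⟨x, a | b⟩ := p
    · exact f.naturality n (x, a)
    · exact g.naturality n (x, b)

def proj {I : Type v} {F : I → ToT.{u}} (i : I) : Hom (pi F) (F i) :=
  ⟨fun _ x => x i, fun _ _ => rfl⟩

def tuple {I : Type v} {F : I → ToT.{u}} (f : ∀ i, Hom X (F i)) : Hom X (pi F) :=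
  ⟨fun n x i => (f i).app n x, fun n x => funext fun i => (f i).naturality n x⟩

def eval : Hom (prod (exp X Y) X) Y :=
  ⟨fun n p => p.1.1 n le_rfl p.2, fun n p => p.1.2 n le_rfl p.2⟩

def curry (f : Hom (prod X Y) Z) : Hom X (exp Y Z) where
  app n x := ⟨fun _ h y => f.app _ (X.down h x, y), fun j h y => by
    refine (f.naturality j _).trans ?_
    exact congrArg (fun z => f.app j (z, Y.res j y)) (X.res_down h (Nat.le_of_succ_le h) x)⟩
  naturality n x := by
    apply Subtype.ext
    funext j h y
    exact congrArg (fun z => f.app j (z, y)) (X.down_succ h (h.trans n.le_succ) x)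

/-- `next : X → ▷X`. -/
def next (X : ToT.{u}) : Hom X (later X) where
  app
    | 0 => fun _ => PUnit.unit
    | n + 1 => X.res n
  naturality
    | 0, _ => rfl
    | _ + 1, _ => rfl

/-- The functorial action of `▷`. -/
def laterMap (f : Hom X Y) : Hom (later X) (later Y) where
  app
    | 0 => fun _ => PUnit.unit
    | n + 1 => f.app n
  naturality
    | 0, _ => rfl
    | n + 1, x => f.naturality n x

/-- `▷X × ▷Y → ▷(X × Y)`. -/
def laterPair : Hom (prod (later X) (later Y)) (later (prod X Y)) where
  app
    | 0 => fun _ => PUnit.unit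
    | _ + 1 => fun p => p
  naturality
    | 0, _ => rfl
    | _ + 1, _ => rfl

/-- Later application `⊛ : ▷(X → Y) × ▷X → ▷Y`. -/
def laterApp : Hom (prod (later (exp X Y)) (later X)) (later Y) :=
  laterPair.comp (laterMap eval)

/-- The stages of the guarded fixed point. -/
def fixApp {G : ToT.{u}} {A : ToT.{v}} (f : Hom (prod G (later A)) A) : ∀ n, G.obj n → A.obj n
  | 0 => fun g => f.app 0 (g, PUnit.unit)
  | n + 1 => fun g => f.app (n + 1) (g, fixApp f n (G.res n g))

/-- The guarded fixed point, in a context `G`, of a map `▷A → A`: the unique solution of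
`fix f (g) = f (g, next (fix f (g)))`. -/
def fix {G : ToT.{u}} {A : ToT.{v}} (f : Hom (prod G (later A)) A) : Hom G A where
  app := fixApp f
  naturality n := by
    induction n with
    | zero => exact fun g => f.naturality 0 _
    | succ n ih =>
      intro g
      refine (f.naturality (n + 1) _).trans ?_
      change f.app (n + 1) (G.res (n + 1) g, A.res n (fixApp f (n + 1) (G.res (n + 1) g))) = _
      rw [ih]
      rfl

/-- `η : A → LA`. -/
def eta (A : ToT.{u}) : Hom A (lift A) where
  app
    | 0 => Sum.inl
    | _ + 1 => Sum.inl
  naturality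
    | 0, _ => rfl
    | _ + 1, _ => rfl

/-- The algebra structure `▷LA → LA` of the lifting. -/
def liftTick (A : ToT.{u}) : Hom (later (lift A)) (lift A) where
  app
    | 0 => Sum.inr
    | _ + 1 => Sum.inr
  naturality
    | 0, _ => rfl
    | _ + 1, _ => rfl

/-- The stages of the extension of `f` to the lifting. -/
def extendApp {G : ToT.{u}} {A : ToT.{v}} {B : ToT.{w}}
    (t : Hom (later B) B) (f : Hom (prod G A) B) : ∀ n, G.obj n → (lift A).obj n → B.obj n
  | 0 => fun g => Sum.elim (fun a => f.app 0 (g, a)) (fun _ => t.app 0 PUnit.unit)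
  | n + 1 => fun g => Sum.elim (fun a => f.app (n + 1) (g, a))
      (fun r => t.app (n + 1) (extendApp t f n (G.res n g) r))

/-- The extension, in a context `G`, of `f : A → B` to a homomorphism from `LA` to the
`▷`-algebra `(B, t)`: `η(a) ↦ f(a)` and `tick(r) ↦ t(next(extend f) ⊛ r)`. -/
def extend {G : ToT.{u}} {A : ToT.{v}} {B : ToT.{w}}
    (t : Hom (later B) B) (f : Hom (prod G A) B) : Hom (prod G (lift A)) B where
  app n p := extendApp t f n p.1 p.2
  naturality n := by
    induction n with
    | zero =>
      rintro ⟨g, a | r⟩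
      · exact f.naturality 0 (g, a)
      · exact t.naturality 0 _
    | succ n ih =>
      rintro ⟨g, a | r⟩
      · exact f.naturality (n + 1) (g, a)
      · refine (t.naturality (n + 1) _).trans ?_
        exact congrArg (t.app (n + 1)) (ih (G.res (n + 1) g, r))

end Hom

/-! ## The universe of small objects -/

/-- An element of the universe at stage `n`: a small object as it looks at the stages `m ≤ n`. -/
structure Code (n : ℕ) : Type 1 where
  obj : ∀ m, m ≤ n → Type
  res : ∀ m (h : m + 1 ≤ n), obj (m + 1) h → obj m (Nat.le_of_succ_le h)

namespace Code

variable {n : ℕ}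

theorem ext_of_heq {A B : Code n} (e : ∀ m h, A.obj m h = B.obj m h)
    (e' : ∀ m h x, HEq (A.res m h x) (B.res m h (cast (e _ _) x))) : A = B := by
  obtain ⟨Ao, Ar⟩ := A
  obtain ⟨Bo, Br⟩ := B
  obtain rfl : Ao = Bo := funext fun m => funext fun h => e m h
  congr
  funext m h x
  exact eq_of_heq (e' m h x)

/-- Truncation of a code to an earlier stage. -/
def trunc {m : ℕ} (h : m ≤ n) (A : Code n) : Code m :=
  ⟨fun j hj => A.obj j (hj.trans h), fun j hj => A.res j (hj.trans h)⟩

def prod (A B : Code n) : Code n :=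
  ⟨fun m h => A.obj m h × B.obj m h, fun m h p => (A.res m h p.1, B.res m h p.2)⟩

def sum (A B : Code n) : Code n :=
  ⟨fun m h => A.obj m h ⊕ B.obj m h, fun m h => Sum.map (A.res m h) (B.res m h)⟩

def arr (A B : Code n) : Code n where
  obj m hm := {f : ∀ j (h : j ≤ m), A.obj j (h.trans hm) → B.obj j (h.trans hm) //
    ∀ j (h : j + 1 ≤ m) x, B.res j (h.trans hm) (f (j + 1) h x) =
      f j (Nat.le_of_succ_le h) (A.res j (h.trans hm) x)}
  res m _ f := ⟨fun j h => f.1 j (h.trans m.le_succ), fun j h => f.2 j (h.trans m.le_succ)⟩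

end Code

/-- The code at stage `n` of a small object. -/
def code (X : ToT.{0}) (n : ℕ) : Code n := ⟨fun m _ => X.obj m, fun m _ => X.res m⟩

/-- The universe, an object of the topos of trees (of large sets). -/
def U : ToT.{1} := ⟨Code, fun n => Code.trunc n.le_succ⟩

/-- The underlying family of `▷A`, where `A` is an element of the universe that is available one
step later. -/
def laterCodeObj : ∀ (n : ℕ), (later U).obj n → ∀ m, m ≤ n → Type
  | _, _, 0, _ => PUnit
  | 0, _, _ + 1, h => absurd h (Nat.not_succ_le_zero _)
  | _ + 1, A, m + 1, h => Code.obj A m (Nat.le_of_succ_le_succ h)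

def laterCodeRes : ∀ (n : ℕ) (A : (later U).obj n) (m : ℕ) (h : m + 1 ≤ n),
    laterCodeObj n A (m + 1) h → laterCodeObj n A m (Nat.le_of_succ_le h)
  | 0, _, _, h => absurd h (Nat.not_succ_le_zero _)
  | _ + 1, _, 0, _ => fun _ => PUnit.unit
  | _ + 1, A, m + 1, h => Code.res A m (Nat.le_of_succ_le_succ h)

/-- The code of the later operator, `▷U → U`. -/
def laterCode : Hom (later U) U where
  app n A := (⟨laterCodeObj n A, laterCodeRes n A⟩ : Code n)
  naturality n A := by
    cases n with
    | zero =>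
      refine Code.ext_of_heq ?_ ?_
      · intro m h
        obtain rfl : m = 0 := by omega
        rfl
      · intro m h
        omega
    | succ n =>
      refine Code.ext_of_heq ?_ ?_
      · intro m h
        cases m <;> rfl
      · intro m h x
        cases m <;> exact HEq.rfl

/-- The decoding of a global element of the universe: the small object it names. -/
def El (A : Hom one.{1} U) : ToT.{0} where
  obj n := Code.obj (A.app n PUnit.unit) n le_rfl
  res n x := cast
    (congrArg (fun B : Code n => B.obj n le_rfl) (A.naturality n PUnit.unit))
    (Code.res (A.app (n + 1) PUnit.unit) n le_rfl x)

theorem app_trunc (A : Hom one.{1} U) {m n : ℕ} (h : m ≤ n) :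
    Code.trunc h (A.app n PUnit.unit) = A.app m PUnit.unit := by
  induction n with
  | zero =>
    obtain rfl : m = 0 := by omega
    rfl
  | succ n ih =>
    rcases Nat.lt_or_ge n m with hm | hm
    · obtain rfl : m = n + 1 := by omega
      rfl
    · exact (congrArg (Code.trunc hm) (A.naturality n PUnit.unit)).trans (ih hm)

theorem El_eq {A : Hom one.{1} U} {X : ToT.{0}} (h : ∀ n, A.app n PUnit.unit = X.code n) :
    El A = X := by
  obtain ⟨a, ha⟩ := A
  obtain rfl : a = fun n _ => X.code n := funext fun n => funext fun _ => h n
  rfl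

theorem code_El (A : Hom one.{1} U) (n : ℕ) : (El A).code n = A.app n PUnit.unit := by
  have key : ∀ m (h : m ≤ n), (El A).obj m = Code.obj (A.app n PUnit.unit) m h := fun m h =>
    congrArg (fun B : Code m => B.obj m le_rfl) (app_trunc A h).symm
  refine Code.ext_of_heq key ?_
  intro m h x
  have aux : ∀ (B C : Code (m + 1)) (_ : B = C) (y : B.obj (m + 1) le_rfl)
      (z : C.obj (m + 1) le_rfl), HEq y z →
      HEq (B.res m le_rfl y) (C.res m le_rfl z) := by
    rintro B C rfl y z hyz
    rw [eq_of_heq hyz]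
  refine (cast_heq _ _).trans ?_
  exact aux _ _ (app_trunc A h).symm _ _ (cast_heq _ _).symm

theorem laterCode_next_code (X : ToT.{0}) (n : ℕ) :
    laterCode.app n ((Hom.next U).app n (X.code n)) = X.later.code n := by
  cases n with
  | zero =>
    refine Code.ext_of_heq ?_ ?_
    · intro m h
      obtain rfl : m = 0 := by omega
      rfl
    · intro m h
      omega
  | succ n =>
    refine Code.ext_of_heq ?_ ?_
    · intro m h
      cases m <;> rfl
    · intro m h x
      cases m <;> exact HEq.rfl

/-- The codes of binary products, coproducts and exponentials, as morphisms. -/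
def prodCode : Hom (prod U U) U := ⟨fun n p => Code.prod (n := n) p.1 p.2, fun _ _ => rfl⟩

def sumCode : Hom (prod U U) U := ⟨fun n p => Code.sum (n := n) p.1 p.2, fun _ _ => rfl⟩

def arrCode : Hom (prod U U) U := ⟨fun n p => Code.arr (n := n) p.1 p.2, fun _ _ => rfl⟩

/-- The code of a small object, as a global element of the universe. -/
def codeHom (X : ToT.{0}) : Hom one.{1} U := ⟨fun n _ => X.code n, fun _ _ => rfl⟩

/-- The code of the lifting: the guarded fixed point, in the context `A : U`, of the map
`X ↦ A + ▷X` from `▷U` to `U`. -/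
def liftCode : Hom U U :=
  Hom.fix ((Hom.pair Hom.fst (Hom.snd.comp laterCode)).comp sumCode)

theorem sum_lift (A : ToT.{0}) : sum A (later (lift A)) = lift A := by
  have key : ∀ m, (sum A (later (lift A))).obj m = (lift A).obj m := by
    intro m
    cases m <;> rfl
  refine (El_eq (A := codeHom (sum A (later (lift A)))) fun _ => rfl).symm.trans (El_eq ?_)
  intro n
  refine Code.ext_of_heq (fun m _ => key m) ?_
  intro m h x
  cases m with
  | zero => obtain x | x := x <;> exact HEq.rfl
  | succ m => obtain x | x := x <;> exact HEq.rfl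

theorem liftCode_code (A : ToT.{0}) (n : ℕ) : liftCode.app n (A.code n) = A.lift.code n := by
  have step : ∀ n, Code.sum (A.code n) (laterCode.app n ((Hom.next U).app n (A.lift.code n)))
      = A.lift.code n := by
    intro n
    rw [laterCode_next_code]
    exact congrArg (fun X => ToT.code X n) (sum_lift A)
  induction n with
  | zero => exact step 0
  | succ n ih =>
    refine Eq.trans ?_ (step (n + 1))
    exact congrArg (fun B => Code.sum (A.code (n + 1)) (laterCode.app (n + 1) B)) ih

end ToT

/-! ## Syntax of FPC -/

namespace FPC

/-- FPC types with type variables from `Fin k`. -/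
inductive Ty : ℕ → Type
  | var {k : ℕ} (i : Fin k) : Ty k
  | one {k : ℕ} : Ty k
  | sum {k : ℕ} (a b : Ty k) : Ty k
  | prod {k : ℕ} (a b : Ty k) : Ty k
  | arr {k : ℕ} (a b : Ty k) : Ty k
  | mu {k : ℕ} (a : Ty (k + 1)) : Ty k

namespace Ty

def rename : {k l : ℕ} → (Fin k → Fin l) → Ty k → Ty l
  | _, _, r, var i => var (r i)
  | _, _, _, one => one
  | _, _, r, sum a b => sum (a.rename r) (b.rename r)
  | _, _, r, prod a b => prod (a.rename r) (b.rename r)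
  | _, _, r, arr a b => arr (a.rename r) (b.rename r)
  | _, _, r, mu a => mu (a.rename (Fin.cons 0 fun i => (r i).succ))

/-- Simultaneous capture-avoiding substitution. -/
def subst : {k l : ℕ} → (Fin k → Ty l) → Ty k → Ty l
  | _, _, s, var i => s i
  | _, _, _, one => one
  | _, _, s, sum a b => sum (a.subst s) (b.subst s)
  | _, _, s, prod a b => prod (a.subst s) (b.subst s)
  | _, _, s, arr a b => arr (a.subst s) (b.subst s)
  | _, _, s, mu a => mu (a.subst (Fin.cons (var 0) fun i => (s i).rename Fin.succ))

/-- `τ[σ/α]` for the most recently bound variable `α`. -/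
def inst {k : ℕ} (a : Ty (k + 1)) (b : Ty k) : Ty k := a.subst (Fin.cons b var)

end Ty

/-- FPC terms with variables from `Fin n`; the closed terms are `Term 0`. The terms `M` and `N` in
`case L M N`, and the body of a `lam`, bind the variable `0`. -/
inductive Term : ℕ → Type
  | var {n : ℕ} (i : Fin n) : Term n
  | unit {n : ℕ} : Term n
  | inl {n : ℕ} (M : Term n) : Term n
  | inr {n : ℕ} (M : Term n) : Term n
  | case {n : ℕ} (L : Term n) (M N : Term (n + 1)) : Term n
  | pair {n : ℕ} (M N : Term n) : Term n
  | fst {n : ℕ} (M : Term n) : Term n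
  | snd {n : ℕ} (M : Term n) : Term n
  | lam {n : ℕ} (t : Ty 0) (M : Term (n + 1)) : Term n
  | app {n : ℕ} (M N : Term n) : Term n
  | fold {n : ℕ} (M : Term n) : Term n
  | unfold {n : ℕ} (M : Term n) : Term n

namespace Term

def rename : {m n : ℕ} → (Fin m → Fin n) → Term m → Term n
  | _, _, r, var i => var (r i)
  | _, _, _, unit => unit
  | _, _, r, inl M => inl (M.rename r)
  | _, _, r, inr M => inr (M.rename r)
  | _, _, r, case L M N => case (L.rename r) (M.rename (Fin.cons 0 fun i => (r i).succ))
      (N.rename (Fin.cons 0 fun i => (r i).succ))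
  | _, _, r, pair M N => pair (M.rename r) (N.rename r)
  | _, _, r, fst M => fst (M.rename r)
  | _, _, r, snd M => snd (M.rename r)
  | _, _, r, lam t M => lam t (M.rename (Fin.cons 0 fun i => (r i).succ))
  | _, _, r, app M N => app (M.rename r) (N.rename r)
  | _, _, r, fold M => fold (M.rename r)
  | _, _, r, unfold M => unfold (M.rename r)

/-- Simultaneous capture-avoiding substitution. -/
def subst : {m n : ℕ} → (Fin m → Term n) → Term m → Term n
  | _, _, s, var i => s i
  | _, _, _, unit => unit
  | _, _, s, inl M => inl (M.subst s)
  | _, _, s, inr M => inr (M.subst s)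
  | _, _, s, case L M N => case (L.subst s)
      (M.subst (Fin.cons (var 0) fun i => (s i).rename Fin.succ))
      (N.subst (Fin.cons (var 0) fun i => (s i).rename Fin.succ))
  | _, _, s, pair M N => pair (M.subst s) (N.subst s)
  | _, _, s, fst M => fst (M.subst s)
  | _, _, s, snd M => snd (M.subst s)
  | _, _, s, lam t M => lam t (M.subst (Fin.cons (var 0) fun i => (s i).rename Fin.succ))
  | _, _, s, app M N => app (M.subst s) (N.subst s)
  | _, _, s, fold M => fold (M.subst s)
  | _, _, s, unfold M => unfold (M.subst s)

/-- `M[N/x]` for the most recently bound variable `x`. -/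
def inst {n : ℕ} (M : Term (n + 1)) (N : Term n) : Term n := M.subst (Fin.cons N var)

end Term

/-- Derivations of the typing judgement `Γ ⊢ M : σ`, where `Γ` assigns closed types to the
variables. -/
inductive HasType : {n : ℕ} → (Fin n → Ty 0) → Term n → Ty 0 → Type
  | var {n : ℕ} {Γ : Fin n → Ty 0} (i : Fin n) : HasType Γ (.var i) (Γ i)
  | unit {n : ℕ} {Γ : Fin n → Ty 0} : HasType Γ .unit .one
  | lam {n : ℕ} {Γ : Fin n → Ty 0} {s t : Ty 0} {M : Term (n + 1)}
      (d : HasType (Fin.cons s Γ) M t) : HasType Γ (.lam s M) (.arr s t)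
  | app {n : ℕ} {Γ : Fin n → Ty 0} {s t : Ty 0} {M N : Term n}
      (d : HasType Γ M (.arr s t)) (e : HasType Γ N s) : HasType Γ (.app M N) t
  | inl {n : ℕ} {Γ : Fin n → Ty 0} {s t : Ty 0} {M : Term n}
      (d : HasType Γ M s) : HasType Γ (.inl M) (.sum s t)
  | inr {n : ℕ} {Γ : Fin n → Ty 0} {s t : Ty 0} {M : Term n}
      (d : HasType Γ M t) : HasType Γ (.inr M) (.sum s t)
  | case {n : ℕ} {Γ : Fin n → Ty 0} {s t u : Ty 0} {L : Term n} {M N : Term (n + 1)}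
      (d : HasType Γ L (.sum s t)) (e : HasType (Fin.cons s Γ) M u)
      (f : HasType (Fin.cons t Γ) N u) : HasType Γ (.case L M N) u
  | fst {n : ℕ} {Γ : Fin n → Ty 0} {s t : Ty 0} {M : Term n}
      (d : HasType Γ M (.prod s t)) : HasType Γ (.fst M) s
  | snd {n : ℕ} {Γ : Fin n → Ty 0} {s t : Ty 0} {M : Term n}
      (d : HasType Γ M (.prod s t)) : HasType Γ (.snd M) t
  | pair {n : ℕ} {Γ : Fin n → Ty 0} {s t : Ty 0} {M N : Term n}
      (d : HasType Γ M s) (e : HasType Γ N t) : HasType Γ (.pair M N) (.prod s t)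
  | unfold {n : ℕ} {Γ : Fin n → Ty 0} {t : Ty 1} {M : Term n}
      (d : HasType Γ M (.mu t)) : HasType Γ (.unfold M) (t.inst (.mu t))
  | fold {n : ℕ} {Γ : Fin n → Ty 0} {t : Ty 1} {M : Term n}
      (d : HasType Γ M (t.inst (.mu t))) : HasType Γ (.fold M) (.mu t)

/-! ## Operational semantics -/

/-- Evaluation contexts. -/
inductive ECtx : Type
  | hole : ECtx
  | app (E : ECtx) (M : Term 0) : ECtx
  | case (E : ECtx) (M N : Term 1) : ECtx
  | fst (E : ECtx) : ECtx
  | snd (E : ECtx) : ECtx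
  | unfold (E : ECtx) : ECtx

/-- `E[M]`. -/
def ECtx.plug : ECtx → Term 0 → Term 0
  | hole, L => L
  | app E M, L => .app (E.plug L) M
  | case E M N, L => .case (E.plug L) M N
  | fst E, L => .fst (E.plug L)
  | snd E, L => .snd (E.plug L)
  | unfold E, L => .unfold (E.plug L)

/-- Derivations of the call-by-name small-step relation `M →ᵏ N` on closed terms; `k` counts the
unfold-fold reductions. -/
inductive Step : Term 0 → ℕ → Term 0 → Type
  | beta (s : Ty 0) (M : Term 1) (N : Term 0) : Step (.app (.lam s M) N) 0 (M.inst N)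
  | unfold_fold (M : Term 0) : Step (.unfold (.fold M)) 1 M
  | case_inl (L : Term 0) (M N : Term 1) : Step (.case (.inl L) M N) 0 (M.inst L)
  | case_inr (L : Term 0) (M N : Term 1) : Step (.case (.inr L) M N) 0 (N.inst L)
  | fst_pair (M N : Term 0) : Step (.fst (.pair M N)) 0 M
  | snd_pair (M N : Term 0) : Step (.snd (.pair M N)) 0 N
  | ctx (E : ECtx) {M N : Term 0} {k : ℕ} (h : Step M k N) : Step (E.plug M) k (E.plug N)

/-- Derivations of the reflexive transitive closure `M →*ᵏ N`, with `k` unfold-fold reductions. -/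
inductive Steps : Term 0 → ℕ → Term 0 → Type
  | refl (M : Term 0) : Steps M 0 M
  | step {M M' N : Term 0} {k m : ℕ} (h : Step M k M') (t : Steps M' m N) : Steps M (k + m) N

open ToT

/-- The guarded transitive closure `M ⇒ᵏ N`, as a type with one guard `▷` per unfold-fold
reduction: `M ⇒⁰ N` is `M →*⁰ N`, and `M ⇒ᵏ⁺¹ N` consists of terms `M'`, `M''` with `M →*⁰ M'`,
`M' →¹ M''` and `▷ (M'' ⇒ᵏ N)`. -/
def GSteps : ℕ → Term 0 → Term 0 → ToT.{0}
  | 0, M, N => const (Steps M 0 N)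
  | k + 1, M, N => sigma fun M' : Term 0 => sigma fun M'' : Term 0 =>
      prod (const (Steps M 0 M')) (prod (const (Step M' 1 M'')) (later (GSteps k M'' N)))

/-! ## Interpretation of types -/

/-- `U × ⋯ × U`. -/
abbrev UPow (k : ℕ) : ToT.{1} := pi fun _ : Fin k => U

/-- `(ρ, Y) ↦ ρ, Y`. -/
def UPow.cons (k : ℕ) : Hom (ToT.prod (UPow k) U) (UPow (k + 1)) :=
  Hom.tuple (Fin.cons Hom.snd fun i => Hom.fst.comp (Hom.proj i))

namespace Ty

/-- The interpretation `U × ⋯ × U → U` of a type with `k` type variables. The interpretation of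
`mu a` is the guarded fixed point, in the context `ρ`, of
`X : ▷U ↦ ▷ (next (fun Y => ⟦a⟧(ρ, Y)) ⊛ X)`. -/
def interp : {k : ℕ} → Ty k → Hom (UPow k) U
  | _, var i => Hom.proj i
  | _, one => (Hom.toOne _).comp (codeHom (lift ToT.one))
  | _, sum a b => ((Hom.pair a.interp b.interp).comp sumCode).comp liftCode
  | _, prod a b => (Hom.pair a.interp b.interp).comp prodCode
  | _, arr a b => (Hom.pair a.interp b.interp).comp arrCode
  | k, mu a => Hom.fix (((Hom.pair (Hom.fst.comp (Hom.next _)) Hom.snd).comp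
      Hom.laterPair).comp ((Hom.laterMap ((UPow.cons k).comp a.interp)).comp laterCode))

theorem interp_mu_succ {k : ℕ} (a : Ty (k + 1)) (n : ℕ) (r : (UPow k).obj (n + 1)) :
    (mu a).interp.app (n + 1) r = laterCode.app (n + 1) (a.interp.app n ((UPow.cons k).app n
      ((UPow k).res n r, (mu a).interp.app n ((UPow k).res n r)))) := rfl

theorem cons_app {k n : ℕ} (r : (UPow k).obj n) (A : Code n) :
    (UPow.cons k).app n (r, A) = (Fin.cons A r : Fin (k + 1) → Code n) := by
  funext i
  refine Fin.cases ?_ (fun j => ?_) i <;> rfl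

theorem interp_rename {k l : ℕ} (a : Ty k) (f : Fin k → Fin l) (n : ℕ) (r : (UPow l).obj n) :
    (a.rename f).interp.app n r = a.interp.app n (fun i => r (f i)) := by
  induction a generalizing l n with
  | var i => rfl
  | one => rfl
  | sum a b iha ihb =>
    exact congrArg₂ (fun A B => liftCode.app n (Code.sum (n := n) A B)) (iha f n r) (ihb f n r)
  | prod a b iha ihb => exact congrArg₂ (Code.prod (n := n)) (iha f n r) (ihb f n r)
  | arr a b iha ihb => exact congrArg₂ (Code.arr (n := n)) (iha f n r) (ihb f n r)
  | @mu k a ih =>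
    induction n with
    | zero => rfl
    | succ n ihn =>
      refine congrArg (laterCode.app (n + 1)) ?_
      refine (ih _ n _).trans (congrArg (a.interp.app n) ?_)
      funext i
      refine Fin.cases ?_ (fun j => ?_) i
      · exact ihn ((UPow l).res n r)
      · rfl

theorem interp_subst {k l : ℕ} (a : Ty k) (s : Fin k → Ty l) (n : ℕ) (r : (UPow l).obj n) :
    (a.subst s).interp.app n r = a.interp.app n (fun i => (s i).interp.app n r) := by
  induction a generalizing l n with
  | var i => rfl
  | one => rfl
  | sum a b iha ihb =>
    exact congrArg₂ (fun A B => liftCode.app n (Code.sum (n := n) A B)) (iha s n r) (ihb s n r)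
  | prod a b iha ihb => exact congrArg₂ (Code.prod (n := n)) (iha s n r) (ihb s n r)
  | arr a b iha ihb => exact congrArg₂ (Code.arr (n := n)) (iha s n r) (ihb s n r)
  | @mu k a ih =>
    induction n with
    | zero => rfl
    | succ n ihn =>
      refine congrArg (laterCode.app (n + 1)) ?_
      refine (ih _ n _).trans (congrArg (a.interp.app n) ?_)
      funext i
      refine Fin.cases ?_ (fun j => ?_) i
      · refine (ihn ((UPow l).res n r)).trans (congrArg ((mu a).interp.app n) ?_)
        exact funext fun i => ((s i).interp.naturality n r).symm
      · refine (interp_rename (s j) Fin.succ n _).trans ?_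
        exact ((s j).interp.naturality n r).symm

/-- The interpretation of a closed type, as a global element of the universe. -/
def closedCode (a : Ty 0) : Hom ToT.one.{1} U :=
  (Hom.tuple fun i => i.elim0 : Hom ToT.one.{1} (UPow 0)).comp a.interp

/-- The interpretation `⟦a⟧` of a closed type. -/
def den (a : Ty 0) : ToT.{0} := El a.closedCode

theorem interp_closed (a : Ty 0) (n : ℕ) (r : (UPow 0).obj n) :
    a.interp.app n r = a.den.code n := by
  rw [den, code_El]
  refine congrArg (a.interp.app n) ?_
  funext i
  exact i.elim0

theorem den_one : den one = lift ToT.one := El_eq fun _ => rfl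

theorem den_sum (a b : Ty 0) : den (sum a b) = lift (ToT.sum a.den b.den) :=
  El_eq fun n => (congrArg₂ (fun A B => liftCode.app n (Code.sum (n := n) A B))
    (interp_closed a n _) (interp_closed b n _)).trans
    (liftCode_code (ToT.sum a.den b.den) n)

theorem den_prod (a b : Ty 0) : den (prod a b) = ToT.prod a.den b.den :=
  El_eq fun n => congrArg₂ (Code.prod (n := n)) (interp_closed a n _) (interp_closed b n _)

theorem den_arr (a b : Ty 0) : den (arr a b) = exp a.den b.den :=
  El_eq fun n => congrArg₂ (Code.arr (n := n)) (interp_closed a n _) (interp_closed b n _)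

/-- The interpretation of a recursive type is the interpretation of its unfolding, one step
later. -/
theorem den_mu (a : Ty 1) : den (mu a) = later (a.inst (mu a)).den := by
  refine El_eq fun n => ?_
  rw [← laterCode_next_code]
  cases n with
  | zero => rfl
  | succ n =>
    refine congrArg (laterCode.app (n + 1)) ?_
    change _ = (a.inst (mu a)).den.code n
    refine Eq.trans ?_ (interp_closed (a.inst (mu a)) n (fun i => i.elim0))
    refine Eq.trans ?_ (interp_subst a (Fin.cons (mu a) var) n (fun i => i.elim0)).symm
    refine congrArg (a.interp.app n) ?_
    funext i
    refine Fin.cases ?_ (fun j => j.elim0) i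
    refine congrArg ((mu a).interp.app n) ?_
    funext j
    exact j.elim0

/-! ## The `▷`-algebra structure of the interpretation of types -/

/-- The object of families of maps `▷⟦σ⟧ → ⟦σ⟧`, for all closed types `σ`. -/
abbrev TickFam : ToT.{0} := pi fun s : Ty 0 => exp (later s.den) s.den

/-- The body of the guarded recursive definition of the algebra structures, by structural recursion
on the type, in the context of the family that is available one step later. -/
def tickBody : {k : ℕ} → (a : Ty k) → (hk : k = 0) →
    Hom (ToT.prod (later TickFam) (later (hk ▸ a : Ty 0).den)) (hk ▸ a : Ty 0).den
  | _, var i, hk => (Fin.cast hk i).elim0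
  | _, one, rfl => Hom.snd.comp ((Hom.laterMap (Hom.ofEq den_one)).comp
      ((Hom.liftTick _).comp (Hom.ofEq den_one.symm)))
  | _, sum a b, rfl => Hom.snd.comp ((Hom.laterMap (Hom.ofEq (den_sum a b))).comp
      ((Hom.liftTick _).comp (Hom.ofEq (den_sum a b).symm)))
  | _, prod a b, rfl =>
      (Hom.pair
        ((Hom.pair Hom.fst (Hom.snd.comp
          (Hom.laterMap ((Hom.ofEq (den_prod a b)).comp Hom.fst)))).comp (tickBody a rfl))
        ((Hom.pair Hom.fst (Hom.snd.comp
          (Hom.laterMap ((Hom.ofEq (den_prod a b)).comp Hom.snd)))).comp (tickBody b rfl))).comp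
      (Hom.ofEq (den_prod a b).symm)
  | _, arr a b, rfl =>
      (Hom.curry ((Hom.pair (Hom.fst.comp Hom.fst)
        ((Hom.pair (Hom.fst.comp (Hom.snd.comp (Hom.laterMap (Hom.ofEq (den_arr a b)))))
          (Hom.snd.comp (Hom.next a.den))).comp Hom.laterApp)).comp (tickBody b rfl))).comp
      (Hom.ofEq (den_arr a b).symm)
  | _, mu a, rfl =>
      ((Hom.pair (Hom.fst.comp (Hom.laterMap (Hom.proj (a.inst (mu a)))))
        (Hom.snd.comp (Hom.laterMap (Hom.ofEq (den_mu a))))).comp Hom.laterApp).comp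
      (Hom.ofEq (den_mu a).symm)

/-- The family of algebra structures, as a guarded fixed point. -/
def tickFam : Hom ToT.one.{0} TickFam :=
  Hom.fix (Hom.snd.comp (Hom.tuple fun s : Ty 0 => Hom.curry (tickBody s rfl)))

/-- The algebra structure `▷⟦σ⟧ → ⟦σ⟧`. -/
def tick (s : Ty 0) : Hom (later s.den) s.den :=
  (Hom.pair ((Hom.toOne _).comp (tickFam.comp (Hom.proj s))) (Hom.id _)).comp Hom.eval

/-- The delay map `δ = tick ∘ next`. -/
def delay (s : Ty 0) : Hom s.den s.den := (Hom.next _).comp s.tick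

end Ty

/-! ## Interpretation of terms -/

/-- The interpretation of a context, the product of the interpretations of its types. -/
abbrev Ctx {n : ℕ} (Γ : Fin n → Ty 0) : ToT.{0} := pi fun i => (Γ i).den

/-- `(γ, x) ↦ γ, x`. -/
def Ctx.cons {n : ℕ} (Γ : Fin n → Ty 0) (s : Ty 0) :
    Hom (ToT.prod (Ctx Γ) s.den) (Ctx (Fin.cons s Γ : Fin (n + 1) → Ty 0)) :=
  Hom.tuple (Fin.cases Hom.snd fun i => Hom.fst.comp (Hom.proj i))

/-- The element `*` of the interpretation of the empty context. -/
def Ctx.star : Hom ToT.one.{0} (Ctx (Fin.elim0 : Fin 0 → Ty 0)) := Hom.tuple fun i => i.elim0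

/-- The interpretation `⟦Γ⟧ → ⟦σ⟧` of a typing judgement `Γ ⊢ M : σ`. The maps `Hom.ofEq` are
identities between equal objects. -/
def HasType.den : {n : ℕ} → {Γ : Fin n → Ty 0} → {M : Term n} → {s : Ty 0} →
    HasType Γ M s → Hom (Ctx Γ) s.den
  | _, Γ, _, _, @HasType.var _ _ i => Hom.proj (F := fun i => (Γ i).den) i
  | _, _, _, _, .unit => ((Hom.toOne _).comp (Hom.eta _)).comp (Hom.ofEq Ty.den_one.symm)
  | _, Γ, _, _, .lam (s := s) (t := t) d =>
      (Hom.curry ((Ctx.cons Γ s).comp d.den)).comp (Hom.ofEq (Ty.den_arr s t).symm)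
  | _, _, _, _, .app (s := s) (t := t) d e =>
      (Hom.pair (d.den.comp (Hom.ofEq (Ty.den_arr s t))) e.den).comp Hom.eval
  | _, _, _, _, .inl (s := s) (t := t) d =>
      (d.den.comp (Hom.inl.comp (Hom.eta _))).comp (Hom.ofEq (Ty.den_sum s t).symm)
  | _, _, _, _, .inr (s := s) (t := t) d =>
      (d.den.comp (Hom.inr.comp (Hom.eta _))).comp (Hom.ofEq (Ty.den_sum s t).symm)
  | _, Γ, _, _, .case (s := s) (t := t) (u := u) d e f =>
      (Hom.pair (Hom.id _) (d.den.comp (Hom.ofEq (Ty.den_sum s t)))).comp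
        (Hom.extend u.tick
          (Hom.copair ((Ctx.cons Γ s).comp e.den) ((Ctx.cons Γ t).comp f.den)))
  | _, _, _, _, .fst (s := s) (t := t) d =>
      (d.den.comp (Hom.ofEq (Ty.den_prod s t))).comp Hom.fst
  | _, _, _, _, .snd (s := s) (t := t) d =>
      (d.den.comp (Hom.ofEq (Ty.den_prod s t))).comp Hom.snd
  | _, _, _, _, .pair (s := s) (t := t) d e =>
      (Hom.pair d.den e.den).comp (Hom.ofEq (Ty.den_prod s t).symm)
  | _, _, _, _, .unfold (t := t) d =>
      (d.den.comp (Hom.ofEq (Ty.den_mu t))).comp (t.inst (.mu t)).tick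
  | _, _, _, _, .fold (t := t) d =>
      (d.den.comp (Hom.next _)).comp (Hom.ofEq (Ty.den_mu t).symm)

/-- The element `η(*)` of the interpretation of the unit type. -/
def etaStar : Hom ToT.one.{0} (Ty.den .one) := (Hom.eta _).comp (Hom.ofEq Ty.den_one.symm)

end FPC

/-!
Everything is computed stage by stage. At stage `n` the type `M ⇒ᵏ N` only sees the first `n + 1`
unfold-fold reductions, and the equation `⟦M⟧(*) = δᵏ(η(*))` only sees the first `n + 1` delays.

From left to right the theorem is soundness. A reduction `→⁰` does not change the interpretation of
a term, and a reduction `→¹` takes off one delay `δ` (`Step.denotes`). The head reductions come from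
the substitution lemma `Denotes.subst`; evaluation contexts are harmless because each of them is
interpreted by a map that commutes with the delays (`Ty.delay_eval`, `Ty.delay_extend`, …). Since
`δ` at stage `n + 1` depends only on the restriction of its argument to stage `n`, the guard `▷` in
the definition of `M ⇒ᵏ⁺¹ N` costs nothing (`GSteps_sound`).

From right to left, a logical relation `Rel n σ` between `⟦σ⟧(n)` and closed terms is defined by
recursion on `n` and on `σ`. Its unfolding clause at `μα.τ` moves to the larger type `τ[μα.τ/α]`,
but also to the preceding stage. The relation is closed under expansion by `→*⁰` (`Rel.of_red`),
stable under restriction (`Rel.res`) and compatible with the algebra structures (`Rel.tick`), hence every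
closed term is related to its own interpretation (`HasType.rel`). At the type `1` this says that
`⟦M⟧(*) = δᵏ(η(*))` at stage `n` forces `M ⇒ᵏ ⟨⟩` to be inhabited at stage `n`.

A morphism into `M ⇒ᵏ ⟨⟩` has to choose terms and derivations that are compatible with the
restrictions. Reduction is deterministic (`Unfolds.unique`), so one choice serves all stages
(`nonempty_hom_GSteps`).
-/

namespace ToT

/-! ### Generalities on the topos of trees -/

variable {X : ToT.{u}} {Y : ToT.{v}} {Z : ToT.{w}}

/-- Morphisms commute with restriction along several stages. -/
theorem Hom.app_down (f : Hom X Y) {j n : ℕ} (h : j ≤ n) (x : X.obj n) :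
    Y.down h (f.app n x) = f.app j (X.down h x) := by
  induction n with
  | zero =>
    obtain rfl : j = 0 := by omega
    rw [down_self, down_self]
  | succ n ih =>
    rcases Nat.lt_or_ge n j with hj | hj
    · obtain rfl : j = n + 1 := by omega
      rw [down_self, down_self]
    · rw [down_succ Y hj, down_succ X hj, f.naturality, ih hj]

@[simp]
theorem Hom.ofEq_ofEq_symm {X Y : ToT.{u}} (h : X = Y) (n : ℕ) (y : Y.obj n) :
    (Hom.ofEq h).app n ((Hom.ofEq h.symm).app n y) = y := by
  subst h
  rfl

theorem Hom.comp_ofEq_symm_comp_ofEq {Y Z : ToT.{v}} (h : Z = Y) (f : Hom X Y) :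
    (f.comp (Hom.ofEq h.symm)).comp (Hom.ofEq h) = f := by
  subst h
  rfl

theorem Hom.comp_assoc {V : ToT} (f : Hom X Y) (g : Hom Y Z) (h : Hom Z V) :
    (f.comp g).comp h = f.comp (g.comp h) := rfl

theorem Hom.comp_id (f : Hom X Y) : f.comp (Hom.id Y) = f := rfl

theorem Hom.next_laterMap (f : Hom X Y) :
    (Hom.next X).comp (Hom.laterMap f) = f.comp (Hom.next Y) := by
  ext n x
  cases n with
  | zero => rfl
  | succ n => exact (f.naturality n x).symm

theorem down_pi {I : Type v} (F : I → ToT.{u}) {j n : ℕ} (h : j ≤ n) (x : (pi F).obj n) (i : I) :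
    (pi F).down h x i = (F i).down h (x i) :=
  (Hom.app_down (Hom.proj (F := F) i) h x).symm

theorem Hom.comp_curry {V : ToT} (e : Hom V X) (f : Hom (prod X Y) Z) :
    e.comp (Hom.curry f) = Hom.curry ((Hom.pair (Hom.fst.comp e) Hom.snd).comp f) := by
  ext n x
  apply Subtype.ext
  funext j h y
  exact congrArg (fun z => f.app j (z, y)) (e.app_down h x)

theorem Hom.pair_curry_eval {V : ToT} (f : Hom (prod X Y) Z) (a : Hom V X) (b : Hom V Y) :
    (Hom.pair (a.comp (Hom.curry f)) b).comp Hom.eval = (Hom.pair a b).comp f := by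
  ext n x
  exact congrArg (fun z => f.app n (z, b.app n x)) (X.down_self le_rfl _)

/-- The extension of a map to the lifting is natural in the context. -/
theorem Hom.comp_extend {G : ToT.{u}} {G' : ToT} {A : ToT.{v}} {B : ToT.{w}} (e : Hom G' G)
    (t : Hom (later B) B) (f : Hom (prod G A) B) :
    (Hom.pair (Hom.fst.comp e) Hom.snd).comp (Hom.extend t f) =
      Hom.extend t ((Hom.pair (Hom.fst.comp e) Hom.snd).comp f) := by
  ext n ⟨g, x⟩
  change Hom.extendApp t f n (e.app n g) x = Hom.extendApp t _ n g x
  induction n with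
  | zero => rcases x with a | r <;> rfl
  | succ n ih =>
    rcases x with a | r
    · rfl
    · change t.app (n + 1) (extendApp t f n (G.res n (e.app (n + 1) g)) r) = t.app (n + 1) _
      exact congrArg (t.app (n + 1))
        ((congrArg (fun z => extendApp t f n z r) (e.naturality n g)).trans (ih _ r))

theorem Hom.extend_eta {G : ToT.{u}} {A : ToT.{v}} {B : ToT.{w}}
    (t : Hom (later B) B) (f : Hom (prod G A) B) (n : ℕ) (g : G.obj n) (a : A.obj n) :
    (Hom.extend t f).app n (g, (Hom.eta A).app n a) = f.app n (g, a) := by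
  cases n <;> rfl

/-- The extension of a map to the lifting commutes with the algebra structures. -/
theorem Hom.extend_liftTick {G : ToT.{u}} {A : ToT.{v}} {B : ToT.{w}}
    (t : Hom (later B) B) (f : Hom (prod G A) B) (n : ℕ) (g : G.obj n)
    (r : (later (lift A)).obj n) :
    (Hom.extend t f).app n (g, (Hom.liftTick A).app n r) =
      t.app n ((Hom.laterMap (Hom.extend t f)).app n
        (Hom.laterPair.app n ((Hom.next G).app n g, r))) := by
  cases n <;> rfl

theorem Hom.iterate_add (f : Hom X X) (k m : ℕ) :
    f.iterate (k + m) = (f.iterate k).comp (f.iterate m) := by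
  induction m with
  | zero => rfl
  | succ m ih => exact congrArg (fun g : Hom X X => g.comp f) ih

/-- An operation on morphisms that turns one application of `f` into one of `g` does so for their
iterates. -/
theorem Hom.iterate_of_step {V W : ToT} (f : Hom Y Y) (g : Hom Z Z) (F : Hom V Y → Hom W Z)
    (hF : ∀ x, F (x.comp f) = (F x).comp g) (k : ℕ) (x : Hom V Y) :
    F (x.comp (f.iterate k)) = (F x).comp (g.iterate k) := by
  induction k with
  | zero => rfl
  | succ k ih =>
    change F ((x.comp (f.iterate k)).comp f) = ((F x).comp (g.iterate k)).comp g
    rw [hF, ih]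

/-- Later application of delayed arguments is the delayed application. -/
theorem Hom.laterApp_next :
    (Hom.pair (Hom.fst.comp (Hom.next (exp X Y))) (Hom.snd.comp (Hom.next X))).comp Hom.laterApp =
      Hom.eval.comp (Hom.next Y) := by
  ext n p
  cases n with
  | zero => rfl
  | succ n => exact (Hom.eval.naturality n p).symm

theorem Hom.laterPair_next :
    (Hom.pair (Hom.fst.comp (Hom.next X)) (Hom.snd.comp (Hom.next Y))).comp Hom.laterPair =
      Hom.next (prod X Y) := by
  ext n p
  cases n <;> rfl

/-- The extension of a map to the lifting commutes with the delay maps. -/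
theorem Hom.extend_delay {G : ToT.{u}} {A : ToT.{v}} {B : ToT.{w}}
    (t : Hom (later B) B) (f : Hom (prod G A) B) (n : ℕ) (g : G.obj n) (x : (lift A).obj n) :
    (Hom.extend t f).app n (g, (Hom.liftTick A).app n ((Hom.next _).app n x)) =
      t.app n ((Hom.next B).app n ((Hom.extend t f).app n (g, x))) := by
  rw [Hom.extend_liftTick]
  refine congrArg (t.app n) ?_
  refine Eq.trans (congrArg (fun e => (Hom.laterMap (Hom.extend t f)).app n e) ?_)
    (congrArg (fun e : Hom (prod G (lift A)) (later B) => e.app n (g, x))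
      (Hom.next_laterMap (Hom.extend t f)))
  exact congrArg (fun e : Hom (prod G (lift A)) (later (prod G (lift A))) => e.app n (g, x))
    Hom.laterPair_next

theorem down_later_succ (X : ToT.{u}) {j n : ℕ} (h : j ≤ n) (h' : j + 1 ≤ n + 1)
    (x : X.obj n) : (later X).down h' x = X.down h x := by
  induction n with
  | zero =>
    obtain rfl : j = 0 := by omega
    exact (down_self _ _ _).trans (down_self _ _ _).symm
  | succ n ih =>
    rcases Nat.lt_or_ge n j with hj | hj
    · obtain rfl : j = n + 1 := by omega
      exact (down_self _ _ _).trans (down_self _ _ _).symm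
    · exact (down_succ (later X) (Nat.succ_le_succ hj) h' x).trans
        ((ih hj _ _).trans (down_succ X hj h x).symm)

end ToT

namespace FPC

open ToT

/-! ### The algebra structures at the individual types -/

namespace Ty

/-- The family of algebra structures that is available one step later, at stage `n`. -/
def laterTickFam (n : ℕ) : (later TickFam).obj n :=
  (Hom.next TickFam).app n (tickFam.app n PUnit.unit)

theorem laterTickFam_succ (n : ℕ) : laterTickFam (n + 1) = tickFam.app n PUnit.unit :=
  tickFam.naturality n PUnit.unit

theorem down_laterTickFam {j n : ℕ} (h : j ≤ n) :
    (later TickFam).down h (laterTickFam n) = laterTickFam j :=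
  ((tickFam.comp (Hom.next _)).app_down h _).trans
    (congrArg ((Hom.next TickFam).app j) (congrArg (tickFam.app j) rfl))

theorem tickFam_app (n : ℕ) :
    tickFam.app n PUnit.unit = fun s => (Hom.curry (tickBody s rfl)).app n (laterTickFam n) := by
  cases n with
  | zero => rfl
  | succ n => rw [laterTickFam_succ]; rfl

/-- The guarded recursive definition of `tick`, unfolded once. -/
theorem tick_app (s : Ty 0) (n : ℕ) (x : (later s.den).obj n) :
    s.tick.app n x = (tickBody s rfl).app n (laterTickFam n, x) := by
  change (tickFam.app n PUnit.unit s).1 n le_rfl x = _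
  rw [tickFam_app]
  exact congrArg (fun z => (tickBody s rfl).app n (z, x)) (down_self _ le_rfl _)

theorem tick_one : tick one = (Hom.laterMap (Hom.ofEq den_one)).comp
    ((Hom.liftTick _).comp (Hom.ofEq den_one.symm)) := by
  ext n x
  exact tick_app _ n x

theorem tick_sum (a b : Ty 0) : tick (sum a b) = (Hom.laterMap (Hom.ofEq (den_sum a b))).comp
    ((Hom.liftTick _).comp (Hom.ofEq (den_sum a b).symm)) := by
  ext n x
  exact tick_app _ n x

theorem tick_prod (a b : Ty 0) : tick (prod a b) =
    (Hom.pair ((Hom.laterMap ((Hom.ofEq (den_prod a b)).comp Hom.fst)).comp a.tick)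
      ((Hom.laterMap ((Hom.ofEq (den_prod a b)).comp Hom.snd)).comp b.tick)).comp
    (Hom.ofEq (den_prod a b).symm) := by
  ext n x
  refine (tick_app _ n x).trans (congrArg ((Hom.ofEq (den_prod a b).symm).app n) ?_)
  exact Prod.ext (tick_app a n _).symm (tick_app b n _).symm

theorem tick_arr (a b : Ty 0) : tick (arr a b) =
    (Hom.curry ((Hom.pair (Hom.fst.comp (Hom.laterMap (Hom.ofEq (den_arr a b))))
      (Hom.snd.comp (Hom.next a.den))).comp (Hom.laterApp.comp b.tick))).comp
    (Hom.ofEq (den_arr a b).symm) := by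
  ext n x
  refine (tick_app _ n x).trans (congrArg ((Hom.ofEq (den_arr a b).symm).app n) ?_)
  apply Subtype.ext
  funext j h y
  refine Eq.trans ?_ (tick_app b j _).symm
  have e : (ToT.prod (later TickFam) (later (arr a b).den)).down h (laterTickFam n, x) =
      (laterTickFam j, (later (arr a b).den).down h x) :=
    Prod.ext ((Hom.app_down Hom.fst h _).symm.trans (down_laterTickFam h))
      (Hom.app_down Hom.snd h _).symm
  exact congrArg (fun z : (ToT.prod (later TickFam) (later (arr a b).den)).obj j =>
    (tickBody b rfl).app j (z.1, Hom.laterApp.app j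
      ((Hom.laterMap (Hom.ofEq (den_arr a b))).app j z.2, (Hom.next a.den).app j y))) e

theorem tick_mu (a : Ty 1) : tick (mu a) = (Hom.laterMap ((Hom.ofEq (den_mu a)).comp
    (a.inst (mu a)).tick)).comp (Hom.ofEq (den_mu a).symm) := by
  ext n x
  refine (tick_app _ n x).trans (congrArg ((Hom.ofEq (den_mu a).symm).app n) ?_)
  cases n with
  | zero => rfl
  | succ n => rw [laterTickFam_succ]; rfl

end Ty

/-! ### Elimination forms commute with the delays -/

namespace Ty

variable {V : ToT.{0}}

theorem delay_fst (a b : Ty 0) (x : Hom V (prod a b).den) :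
    ((x.comp (prod a b).delay).comp (Hom.ofEq (den_prod a b))).comp Hom.fst =
      ((x.comp (Hom.ofEq (den_prod a b))).comp Hom.fst).comp a.delay := by
  have h : (x.comp (prod a b).delay).comp (Hom.ofEq (den_prod a b)) = x.comp ((Hom.next _).comp
      (Hom.pair ((Hom.laterMap ((Hom.ofEq (den_prod a b)).comp Hom.fst)).comp a.tick)
        ((Hom.laterMap ((Hom.ofEq (den_prod a b)).comp Hom.snd)).comp b.tick))) := by
    rw [delay, tick_prod]
    exact Hom.comp_ofEq_symm_comp_ofEq (den_prod a b) (x.comp ((Hom.next _).comp (Hom.pair _ _)))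
  rw [h]
  exact congrArg (fun g => x.comp (g.comp a.tick))
    (Hom.next_laterMap ((Hom.ofEq (den_prod a b)).comp Hom.fst))

theorem delay_snd (a b : Ty 0) (x : Hom V (prod a b).den) :
    ((x.comp (prod a b).delay).comp (Hom.ofEq (den_prod a b))).comp Hom.snd =
      ((x.comp (Hom.ofEq (den_prod a b))).comp Hom.snd).comp b.delay := by
  have h : (x.comp (prod a b).delay).comp (Hom.ofEq (den_prod a b)) = x.comp ((Hom.next _).comp
      (Hom.pair ((Hom.laterMap ((Hom.ofEq (den_prod a b)).comp Hom.fst)).comp a.tick)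
        ((Hom.laterMap ((Hom.ofEq (den_prod a b)).comp Hom.snd)).comp b.tick))) := by
    rw [delay, tick_prod]
    exact Hom.comp_ofEq_symm_comp_ofEq (den_prod a b) (x.comp ((Hom.next _).comp (Hom.pair _ _)))
  rw [h]
  exact congrArg (fun g => x.comp (g.comp b.tick))
    (Hom.next_laterMap ((Hom.ofEq (den_prod a b)).comp Hom.snd))

theorem delay_eval (a b : Ty 0) (e : Hom V a.den) (x : Hom V (arr a b).den) :
    (Hom.pair ((x.comp (arr a b).delay).comp (Hom.ofEq (den_arr a b))) e).comp Hom.eval =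
      ((Hom.pair (x.comp (Hom.ofEq (den_arr a b))) e).comp Hom.eval).comp b.delay := by
  have h1 : (x.comp (arr a b).delay).comp (Hom.ofEq (den_arr a b)) =
      (x.comp (Hom.next _)).comp (Hom.curry ((Hom.pair
        (Hom.fst.comp (Hom.laterMap (Hom.ofEq (den_arr a b))))
        (Hom.snd.comp (Hom.next a.den))).comp (Hom.laterApp.comp b.tick))) := by
    ext n y
    simp only [delay, tick_arr, Hom.comp, Hom.ofEq_ofEq_symm]
  rw [h1, Hom.pair_curry_eval]
  have h2 := congrArg (fun g => (Hom.pair (x.comp g) (e.comp (Hom.next a.den))).comp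
    (Hom.laterApp.comp b.tick)) (Hom.next_laterMap (Hom.ofEq (den_arr a b)))
  refine Eq.trans h2 ?_
  exact congrArg (fun g => ((Hom.pair (x.comp (Hom.ofEq (den_arr a b))) e).comp g).comp b.tick)
    Hom.laterApp_next

theorem delay_extend (a b c : Ty 0) (f : Hom (ToT.prod V (ToT.sum a.den b.den)) c.den)
    (x : Hom V (sum a b).den) :
    (Hom.pair (Hom.id V) ((x.comp (sum a b).delay).comp (Hom.ofEq (den_sum a b)))).comp
        (Hom.extend c.tick f) =
      ((Hom.pair (Hom.id V) (x.comp (Hom.ofEq (den_sum a b)))).comp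
        (Hom.extend c.tick f)).comp c.delay := by
  ext n y
  refine Eq.trans (congrArg (fun z => (Hom.extend c.tick f).app n (y, z)) ?_)
    (Hom.extend_delay c.tick f n y ((Hom.ofEq (den_sum a b)).app n (x.app n y)))
  simp only [delay, tick_sum, Hom.comp, Hom.ofEq_ofEq_symm]
  exact congrArg ((Hom.liftTick _).app n) (congrArg (fun e : Hom _ _ => e.app n (x.app n y))
    (Hom.next_laterMap (Hom.ofEq (den_sum a b))))

theorem delay_unfold (a : Ty 1) (x : Hom V (mu a).den) :
    ((x.comp (mu a).delay).comp (Hom.ofEq (den_mu a))).comp (a.inst (mu a)).tick =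
      ((x.comp (Hom.ofEq (den_mu a))).comp (a.inst (mu a)).tick).comp (a.inst (mu a)).delay := by
  ext n y
  simp only [delay, tick_mu, Hom.comp, Hom.ofEq_ofEq_symm]
  exact congrArg ((a.inst (mu a)).tick.app n) (congrArg (fun e : Hom _ _ => e.app n (x.app n y))
    (Hom.next_laterMap ((Hom.ofEq (den_mu a)).comp (a.inst (mu a)).tick)))

end Ty

/-! ### The substitution lemma -/

/-- Some derivation of `Γ ⊢ M : s` is interpreted by `f`. A term can have several derivations of the
same judgement, so `f` is not determined by `M` and `s` on syntactic grounds. -/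
def Denotes {n : ℕ} (Γ : Fin n → Ty 0) (M : Term n) (s : Ty 0) (f : Hom (Ctx Γ) s.den) : Prop :=
  ∃ d : HasType Γ M s, d.den = f

theorem HasType.denotes {n : ℕ} {Γ : Fin n → Ty 0} {M : Term n} {s : Ty 0} (d : HasType Γ M s) :
    Denotes Γ M s d.den := ⟨d, rfl⟩

/-- The projection that forgets the most recent variable. -/
def Ctx.weaken {n : ℕ} (Γ : Fin n → Ty 0) (t : Ty 0) :
    Hom (Ctx (Fin.cons t Γ : Fin (n + 1) → Ty 0)) (Ctx Γ) :=
  Hom.tuple (F := fun i => (Γ i).den) fun i =>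
    Hom.proj (F := fun i => ((Fin.cons t Γ : Fin (n + 1) → Ty 0) i).den) i.succ

/-- The interpretations of the terms of a substitution, extended under a binder. -/
def liftDen {m n : ℕ} {Γ : Fin m → Ty 0} {Δ : Fin n → Ty 0} (t : Ty 0)
    (φ : ∀ i, Hom (Ctx Δ) (Γ i).den) (i : Fin (m + 1)) :
    Hom (Ctx (Fin.cons t Δ : Fin (n + 1) → Ty 0)) ((Fin.cons t Γ : Fin (m + 1) → Ty 0) i).den :=
  Fin.cases (motive := fun i => Hom (Ctx (Fin.cons t Δ : Fin (n + 1) → Ty 0))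
      ((Fin.cons t Γ : Fin (m + 1) → Ty 0) i).den)
    (Hom.proj (F := fun i => ((Fin.cons t Δ : Fin (n + 1) → Ty 0) i).den) 0)
    (fun i => (Ctx.weaken Δ t).comp (φ i)) i

theorem cons_comp_tuple_liftDen {m n : ℕ} {Γ : Fin m → Ty 0} {Δ : Fin n → Ty 0} (t : Ty 0)
    (φ : ∀ i, Hom (Ctx Δ) (Γ i).den) :
    (Ctx.cons Δ t).comp (Hom.tuple (liftDen t φ)) =
      (Hom.pair (Hom.fst.comp (Hom.tuple φ)) Hom.snd).comp (Ctx.cons Γ t) := by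
  ext j p
  funext i
  refine Fin.cases ?_ (fun i => ?_) i <;> rfl

namespace Denotes

variable {m n : ℕ} {Γ : Fin m → Ty 0} {Δ : Fin n → Ty 0} {s t u : Ty 0}

theorem of_eq {M : Term m} {f g : Hom (Ctx Γ) s.den} (h : Denotes Γ M s f) (e : f = g) :
    Denotes Γ M s g := e ▸ h

theorem var_succ {i : Fin n} {f : Hom (Ctx Δ) s.den} (h : Denotes Δ (.var i) s f) :
    Denotes (Fin.cons t Δ) (.var i.succ) s ((Ctx.weaken Δ t).comp f) := by
  obtain ⟨d, rfl⟩ := h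
  cases d
  exact ⟨.var (Γ := Fin.cons t Δ) i.succ, rfl⟩

/-- The rule for abstractions, with all interpretations pulled back along a morphism of contexts,
which is extended by `liftDen` below the binder. The lemmas `app_comp`, …, `fold_comp` do the same
for the other rules; together they are the cases of the substitution lemma. -/
theorem lam_comp {φ : ∀ i, Hom (Ctx Δ) (Γ i).den} {M : Term (n + 1)}
    {f : Hom (Ctx (Fin.cons s Γ : Fin (m + 1) → Ty 0)) t.den}
    (h : Denotes (Fin.cons s Δ) M t ((Hom.tuple (liftDen s φ)).comp f)) :
    Denotes Δ (.lam s M) (.arr s t) ((Hom.tuple φ).comp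
      ((Hom.curry ((Ctx.cons Γ s).comp f)).comp (Hom.ofEq (Ty.den_arr s t).symm))) := by
  obtain ⟨d, e⟩ := h
  refine ⟨.lam d, ?_⟩
  change (Hom.curry ((Ctx.cons Δ s).comp d.den)).comp _ = _
  rw [e, ← Hom.comp_assoc, cons_comp_tuple_liftDen, ← Hom.comp_assoc, Hom.comp_curry]
  rfl

theorem app_comp {φ : Hom (Ctx Δ) (Ctx Γ)} {M N : Term n} {f : Hom (Ctx Γ) (Ty.arr s t).den}
    {g : Hom (Ctx Γ) s.den} (h : Denotes Δ M (.arr s t) (φ.comp f))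
    (h' : Denotes Δ N s (φ.comp g)) :
    Denotes Δ (.app M N) t (φ.comp
      ((Hom.pair (f.comp (Hom.ofEq (Ty.den_arr s t))) g).comp Hom.eval)) := by
  obtain ⟨d, e⟩ := h
  obtain ⟨d', e'⟩ := h'
  refine ⟨.app d d', ?_⟩
  change (Hom.pair (d.den.comp _) d'.den).comp _ = _
  rw [e, e']
  rfl

theorem inl_comp {φ : Hom (Ctx Δ) (Ctx Γ)} {M : Term n} {f : Hom (Ctx Γ) s.den}
    (h : Denotes Δ M s (φ.comp f)) : Denotes Δ (.inl M) (.sum s t) (φ.comp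
      ((f.comp (Hom.inl.comp (Hom.eta _))).comp (Hom.ofEq (Ty.den_sum s t).symm))) := by
  obtain ⟨d, e⟩ := h
  refine ⟨.inl d, ?_⟩
  change (d.den.comp _).comp _ = _
  rw [e]
  rfl

theorem inr_comp {φ : Hom (Ctx Δ) (Ctx Γ)} {M : Term n} {f : Hom (Ctx Γ) t.den}
    (h : Denotes Δ M t (φ.comp f)) : Denotes Δ (.inr M) (.sum s t) (φ.comp
      ((f.comp (Hom.inr.comp (Hom.eta _))).comp (Hom.ofEq (Ty.den_sum s t).symm))) := by
  obtain ⟨d, e⟩ := h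
  refine ⟨.inr d, ?_⟩
  change (d.den.comp _).comp _ = _
  rw [e]
  rfl

theorem case_comp {φ : ∀ i, Hom (Ctx Δ) (Γ i).den} {L : Term n} {M N : Term (n + 1)}
    {f : Hom (Ctx Γ) (Ty.sum s t).den} {g : Hom (Ctx (Fin.cons s Γ : Fin (m + 1) → Ty 0)) u.den}
    {h : Hom (Ctx (Fin.cons t Γ : Fin (m + 1) → Ty 0)) u.den}
    (hL : Denotes Δ L (.sum s t) ((Hom.tuple φ).comp f))
    (hM : Denotes (Fin.cons s Δ) M u ((Hom.tuple (liftDen s φ)).comp g))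
    (hN : Denotes (Fin.cons t Δ) N u ((Hom.tuple (liftDen t φ)).comp h)) :
    Denotes Δ (.case L M N) u ((Hom.tuple φ).comp
      ((Hom.pair (Hom.id _) (f.comp (Hom.ofEq (Ty.den_sum s t)))).comp (Hom.extend u.tick
        (Hom.copair ((Ctx.cons Γ s).comp g) ((Ctx.cons Γ t).comp h))))) := by
  obtain ⟨dL, eL⟩ := hL
  obtain ⟨dM, eM⟩ := hM
  obtain ⟨dN, eN⟩ := hN
  refine ⟨.case dL dM dN, ?_⟩
  change (Hom.pair (Hom.id _) (dL.den.comp _)).comp (Hom.extend u.tick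
    (Hom.copair ((Ctx.cons Δ s).comp dM.den) ((Ctx.cons Δ t).comp dN.den))) = _
  rw [eL, eM, eN, ← Hom.comp_assoc (Ctx.cons Δ s), cons_comp_tuple_liftDen,
    ← Hom.comp_assoc (Ctx.cons Δ t), cons_comp_tuple_liftDen]
  have e := Hom.comp_extend (Hom.tuple φ) u.tick
    (Hom.copair ((Ctx.cons Γ s).comp g) ((Ctx.cons Γ t).comp h))
  have e' : (Hom.pair (Hom.fst.comp (Hom.tuple φ)) Hom.snd).comp
      (Hom.copair ((Ctx.cons Γ s).comp g) ((Ctx.cons Γ t).comp h)) =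
      Hom.copair (((Hom.pair (Hom.fst.comp (Hom.tuple φ)) Hom.snd).comp (Ctx.cons Γ s)).comp g)
        (((Hom.pair (Hom.fst.comp (Hom.tuple φ)) Hom.snd).comp (Ctx.cons Γ t)).comp h) := by
    ext j ⟨p, a | b⟩ <;> rfl
  rw [e'] at e
  rw [← e]
  rfl

theorem fst_comp {φ : Hom (Ctx Δ) (Ctx Γ)} {M : Term n} {f : Hom (Ctx Γ) (Ty.prod s t).den}
    (h : Denotes Δ M (.prod s t) (φ.comp f)) :
    Denotes Δ (.fst M) s (φ.comp ((f.comp (Hom.ofEq (Ty.den_prod s t))).comp Hom.fst)) := by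
  obtain ⟨d, e⟩ := h
  refine ⟨.fst d, ?_⟩
  change (d.den.comp _).comp _ = _
  rw [e]
  rfl

theorem snd_comp {φ : Hom (Ctx Δ) (Ctx Γ)} {M : Term n} {f : Hom (Ctx Γ) (Ty.prod s t).den}
    (h : Denotes Δ M (.prod s t) (φ.comp f)) :
    Denotes Δ (.snd M) t (φ.comp ((f.comp (Hom.ofEq (Ty.den_prod s t))).comp Hom.snd)) := by
  obtain ⟨d, e⟩ := h
  refine ⟨.snd d, ?_⟩
  change (d.den.comp _).comp _ = _
  rw [e]
  rfl

theorem pair_comp {φ : Hom (Ctx Δ) (Ctx Γ)} {M N : Term n} {f : Hom (Ctx Γ) s.den}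
    {g : Hom (Ctx Γ) t.den} (h : Denotes Δ M s (φ.comp f)) (h' : Denotes Δ N t (φ.comp g)) :
    Denotes Δ (.pair M N) (.prod s t)
      (φ.comp ((Hom.pair f g).comp (Hom.ofEq (Ty.den_prod s t).symm))) := by
  obtain ⟨d, e⟩ := h
  obtain ⟨d', e'⟩ := h'
  refine ⟨.pair d d', ?_⟩
  change (Hom.pair d.den d'.den).comp _ = _
  rw [e, e']
  rfl

theorem unfold_comp {φ : Hom (Ctx Δ) (Ctx Γ)} {a : Ty 1} {M : Term n}
    {f : Hom (Ctx Γ) (Ty.mu a).den} (h : Denotes Δ M (.mu a) (φ.comp f)) :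
    Denotes Δ (.unfold M) (a.inst (.mu a))
      (φ.comp ((f.comp (Hom.ofEq (Ty.den_mu a))).comp (a.inst (.mu a)).tick)) := by
  obtain ⟨d, e⟩ := h
  refine ⟨.unfold d, ?_⟩
  change (d.den.comp _).comp _ = _
  rw [e]
  rfl

theorem fold_comp {φ : Hom (Ctx Δ) (Ctx Γ)} {a : Ty 1} {M : Term n}
    {f : Hom (Ctx Γ) (a.inst (.mu a)).den} (h : Denotes Δ M (a.inst (.mu a)) (φ.comp f)) :
    Denotes Δ (.fold M) (.mu a)
      (φ.comp ((f.comp (Hom.next _)).comp (Hom.ofEq (Ty.den_mu a).symm))) := by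
  obtain ⟨d, e⟩ := h
  refine ⟨.fold d, ?_⟩
  change (d.den.comp _).comp _ = _
  rw [e]
  rfl

/-- The substitution lemma for renamings. It comes first because substitution below a binder renames
the substituted terms. -/
theorem rename (d : HasType Γ (M : Term m) s) {n : ℕ} {Δ : Fin n → Ty 0} {r : Fin m → Fin n}
    {φ : ∀ i, Hom (Ctx Δ) (Γ i).den} (h : ∀ i, Denotes Δ (.var (r i)) (Γ i) (φ i)) :
    Denotes Δ (M.rename r) s ((Hom.tuple φ).comp d.den) := by
  have lift : ∀ {m n : ℕ} {Γ : Fin m → Ty 0} {Δ : Fin n → Ty 0} {r : Fin m → Fin n}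
      {φ : ∀ i, Hom (Ctx Δ) (Γ i).den} (t : Ty 0),
      (∀ i, Denotes Δ (.var (r i)) (Γ i) (φ i)) →
      ∀ i, Denotes (Fin.cons t Δ) (.var ((Fin.cons 0 fun i => (r i).succ : Fin (m + 1) → _) i))
        ((Fin.cons t Γ : Fin (m + 1) → Ty 0) i) (liftDen t φ i) := by
    intro m n Γ Δ r φ t h i
    refine Fin.cases ?_ (fun i => ?_) i
    · exact ⟨.var (Γ := Fin.cons t Δ) 0, rfl⟩
    · exact (h i).var_succ
  induction d generalizing n with
  | var i => exact h i
  | unit => exact ⟨.unit, rfl⟩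
  | lam d ih => exact lam_comp (ih (lift _ h))
  | app d e ihd ihe => exact app_comp (ihd h) (ihe h)
  | inl d ih => exact inl_comp (ih h)
  | inr d ih => exact inr_comp (ih h)
  | case d e f ihd ihe ihf => exact case_comp (ihd h) (ihe (lift _ h)) (ihf (lift _ h))
  | fst d ih => exact fst_comp (ih h)
  | snd d ih => exact snd_comp (ih h)
  | pair d e ihd ihe => exact pair_comp (ihd h) (ihe h)
  | unfold d ih => exact unfold_comp (ih h)
  | fold d ih => exact fold_comp (ih h)

theorem weaken {M : Term n} {f : Hom (Ctx Δ) s.den} (h : Denotes Δ M s f) (t : Ty 0) :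
    Denotes (Fin.cons t Δ) (M.rename Fin.succ) s ((Ctx.weaken Δ t).comp f) := by
  obtain ⟨d, rfl⟩ := h
  exact rename d (φ := fun i => (Ctx.weaken Δ t).comp (Hom.proj (F := fun i => (Δ i).den) i))
    fun i => var_succ ⟨.var i, rfl⟩

/-- The substitution lemma: substitution is interpreted by composition. -/
theorem subst (d : HasType Γ (M : Term m) s) {n : ℕ} {Δ : Fin n → Ty 0} {σ : Fin m → Term n}
    {φ : ∀ i, Hom (Ctx Δ) (Γ i).den} (h : ∀ i, Denotes Δ (σ i) (Γ i) (φ i)) :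
    Denotes Δ (M.subst σ) s ((Hom.tuple φ).comp d.den) := by
  have lift : ∀ {m n : ℕ} {Γ : Fin m → Ty 0} {Δ : Fin n → Ty 0} {σ : Fin m → Term n}
      {φ : ∀ i, Hom (Ctx Δ) (Γ i).den} (t : Ty 0),
      (∀ i, Denotes Δ (σ i) (Γ i) (φ i)) →
      ∀ i, Denotes (Fin.cons t Δ)
        ((Fin.cons (.var 0) fun i => (σ i).rename Fin.succ : Fin (m + 1) → Term (n + 1)) i)
        ((Fin.cons t Γ : Fin (m + 1) → Ty 0) i) (liftDen t φ i) := by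
    intro m n Γ Δ σ φ t h i
    refine Fin.cases ?_ (fun i => ?_) i
    · exact ⟨.var (Γ := Fin.cons t Δ) 0, rfl⟩
    · exact (h i).weaken t
  induction d generalizing n with
  | var i => exact h i
  | unit => exact ⟨.unit, rfl⟩
  | lam d ih => exact lam_comp (ih (lift _ h))
  | app d e ihd ihe => exact app_comp (ihd h) (ihe h)
  | inl d ih => exact inl_comp (ih h)
  | inr d ih => exact inr_comp (ih h)
  | case d e f ihd ihe ihf => exact case_comp (ihd h) (ihe (lift _ h)) (ihf (lift _ h))
  | fst d ih => exact fst_comp (ih h)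
  | snd d ih => exact snd_comp (ih h)
  | pair d e ihd ihe => exact pair_comp (ihd h) (ihe h)
  | unfold d ih => exact unfold_comp (ih h)
  | fold d ih => exact fold_comp (ih h)

theorem inst {M : Term (n + 1)} {N : Term n} (d : HasType (Fin.cons s Δ) M t)
    (e : HasType Δ N s) : Denotes Δ (M.inst N) t
      ((Hom.pair (Hom.id _) e.den).comp ((Ctx.cons Δ s).comp d.den)) := by
  refine (subst d (φ := Fin.cases e.den fun i => Hom.proj (F := fun i => (Δ i).den) i)
    fun i => ?_).of_eq ?_
  · refine Fin.cases ?_ (fun i => ?_) i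
    · exact e.denotes
    · exact ⟨.var i, rfl⟩
  · ext j p
    refine congrArg (d.den.app j) ?_
    funext i
    refine Fin.cases ?_ (fun i => ?_) i <;> rfl

end Denotes

/-! ### Soundness of reduction -/

/-- Subject reduction and soundness of one reduction step: an unfold-fold reduction is interpreted
by one delay, every other reduction by an equality. -/
theorem Step.denotes {M N : Term 0} {k : ℕ} (h : Step M k N) {Γ : Fin 0 → Ty 0} {s : Ty 0}
    (d : HasType Γ M s) :
    ∃ e : HasType Γ N s, d.den = e.den.comp (s.delay.iterate k) := by
  induction h generalizing s with
  | beta t M N =>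
    cases d with | app d e =>
    cases d with | lam d =>
    obtain ⟨c, hc⟩ := Denotes.inst d e
    refine ⟨c, ?_⟩
    rw [hc]
    change (Hom.pair (((Hom.curry _).comp (Hom.ofEq _)).comp (Hom.ofEq _)) e.den).comp _ = _
    rw [Hom.comp_ofEq_symm_comp_ofEq]
    exact Hom.pair_curry_eval _ (Hom.id _) e.den
  | unfold_fold M =>
    cases d with | unfold d =>
    cases d with | fold d =>
    refine ⟨d, ?_⟩
    change (((d.den.comp _).comp (Hom.ofEq _)).comp (Hom.ofEq _)).comp _ = _
    rw [Hom.comp_ofEq_symm_comp_ofEq]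
    rfl
  | case_inl L M N =>
    cases d with | case d e f =>
    cases d with | inl d =>
    obtain ⟨c, hc⟩ := Denotes.inst e d
    refine ⟨c, ?_⟩
    rw [hc]
    change (Hom.pair _ (((d.den.comp _).comp (Hom.ofEq _)).comp (Hom.ofEq _))).comp _ = _
    rw [Hom.comp_ofEq_symm_comp_ofEq]
    ext n p
    exact Hom.extend_eta _ _ n p _
  | case_inr L M N =>
    cases d with | case d e f =>
    cases d with | inr d =>
    obtain ⟨c, hc⟩ := Denotes.inst f d
    refine ⟨c, ?_⟩
    rw [hc]
    change (Hom.pair _ (((d.den.comp _).comp (Hom.ofEq _)).comp (Hom.ofEq _))).comp _ = _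
    rw [Hom.comp_ofEq_symm_comp_ofEq]
    ext n p
    exact Hom.extend_eta _ _ n p _
  | fst_pair M N =>
    cases d with | fst d =>
    cases d with | pair d e =>
    refine ⟨d, ?_⟩
    change (((Hom.pair _ _).comp (Hom.ofEq _)).comp (Hom.ofEq _)).comp _ = _
    rw [Hom.comp_ofEq_symm_comp_ofEq]
    rfl
  | snd_pair M N =>
    cases d with | snd d =>
    cases d with | pair d e =>
    refine ⟨e, ?_⟩
    change (((Hom.pair _ _).comp (Hom.ofEq _)).comp (Hom.ofEq _)).comp _ = _
    rw [Hom.comp_ofEq_symm_comp_ofEq]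
    rfl
  | @ctx E M N k h ih =>
    -- An evaluation context is a composite of elimination forms, each of which commutes with `δ`.
    induction E generalizing s with
    | hole => exact ih d
    | app E L ihE =>
      cases d with | app d c =>
      obtain ⟨e, he⟩ := ihE d
      refine ⟨.app e c, ?_⟩
      change (Hom.pair (d.den.comp _) c.den).comp _ = _
      rw [he]
      exact Hom.iterate_of_step _ _
        (fun x => (Hom.pair (x.comp (Hom.ofEq (Ty.den_arr _ _))) c.den).comp Hom.eval)
        (Ty.delay_eval _ _ c.den) k e.den
    | case E P Q ihE =>
      cases d with | case d f g =>
      obtain ⟨e, he⟩ := ihE d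
      refine ⟨.case e f g, ?_⟩
      change (Hom.pair _ (d.den.comp _)).comp (Hom.extend _ (Hom.copair (Hom.comp _ f.den)
        (Hom.comp _ g.den))) = _
      rw [he]
      exact Hom.iterate_of_step _ _
        (fun x => (Hom.pair (Hom.id _) (x.comp (Hom.ofEq (Ty.den_sum _ _)))).comp
          (Hom.extend _ (Hom.copair _ _)))
        (Ty.delay_extend _ _ _ _) k e.den
    | fst E ihE =>
      cases d with | fst d =>
      obtain ⟨e, he⟩ := ihE d
      refine ⟨.fst e, ?_⟩
      change (d.den.comp _).comp _ = _
      rw [he]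
      exact Hom.iterate_of_step _ _ (fun x => (x.comp (Hom.ofEq (Ty.den_prod _ _))).comp Hom.fst)
        (Ty.delay_fst _ _) k e.den
    | snd E ihE =>
      cases d with | snd d =>
      obtain ⟨e, he⟩ := ihE d
      refine ⟨.snd e, ?_⟩
      change (d.den.comp _).comp _ = _
      rw [he]
      exact Hom.iterate_of_step _ _ (fun x => (x.comp (Hom.ofEq (Ty.den_prod _ _))).comp Hom.snd)
        (Ty.delay_snd _ _) k e.den
    | unfold E ihE =>
      cases d with | unfold d =>
      obtain ⟨e, he⟩ := ihE d
      refine ⟨.unfold e, ?_⟩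
      change (d.den.comp _).comp _ = _
      rw [he]
      exact Hom.iterate_of_step _ _ (fun x => (x.comp (Hom.ofEq (Ty.den_mu _))).comp _)
        (Ty.delay_unfold _) k e.den

theorem Steps.denotes {M N : Term 0} {k : ℕ} (h : Steps M k N) {Γ : Fin 0 → Ty 0} {s : Ty 0}
    (d : HasType Γ M s) :
    ∃ e : HasType Γ N s, d.den = e.den.comp (s.delay.iterate k) := by
  induction h with
  | refl M => exact ⟨d, rfl⟩
  | @step _ _ _ k m h t ih =>
    obtain ⟨d', h'⟩ := h.denotes d
    obtain ⟨e, he⟩ := ih d'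
    refine ⟨e, ?_⟩
    rw [h', he, Nat.add_comm, Hom.iterate_add]
    rfl

/-! ### Determinism of the reduction relation -/

/-- The reduction strategy: the next term and the number of unfold-fold reductions. -/
def Term.next? {n : ℕ} : Term n → Option (ℕ × Term n)
  | .app (.lam _ M) N => some (0, M.inst N)
  | .app M N => M.next?.map fun p => (p.1, .app p.2 N)
  | .case (.inl L) M _ => some (0, M.inst L)
  | .case (.inr L) _ N => some (0, N.inst L)
  | .case L M N => L.next?.map fun p => (p.1, .case p.2 M N)
  | .fst (.pair M _) => some (0, M)
  | .fst M => M.next?.map fun p => (p.1, .fst p.2)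
  | .snd (.pair _ N) => some (0, N)
  | .snd M => M.next?.map fun p => (p.1, .snd p.2)
  | .unfold (.fold M) => some (1, M)
  | .unfold M => M.next?.map fun p => (p.1, .unfold p.2)
  | _ => none

theorem Step.next?_eq {M N : Term 0} {k : ℕ} (h : Step M k N) : M.next? = some (k, N) := by
  induction h with
  | @ctx E M N k h ih =>
    induction E with
    | hole => exact ih
    | app E L ihE =>
      simp only [ECtx.plug]
      generalize E.plug M = P at ihE
      cases P <;> simp_all [Term.next?]
    | case E K L ihE =>
      simp only [ECtx.plug]
      generalize E.plug M = P at ihE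
      cases P <;> simp_all [Term.next?]
    | fst E ihE =>
      simp only [ECtx.plug]
      generalize E.plug M = P at ihE
      cases P <;> simp_all [Term.next?]
    | snd E ihE =>
      simp only [ECtx.plug]
      generalize E.plug M = P at ihE
      cases P <;> simp_all [Term.next?]
    | unfold E ihE =>
      simp only [ECtx.plug]
      generalize E.plug M = P at ihE
      cases P <;> simp_all [Term.next?]
  | _ => simp [Term.next?]

/-- `M →*⁰ N`, as a proposition. -/
def Red (M N : Term 0) : Prop := Nonempty (Steps M 0 N)

/-- `M →*⁰ M' →¹ N` for some `M'`. -/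
def Unfolds (M N : Term 0) : Prop := ∃ M', Red M M' ∧ Nonempty (Step M' 1 N)

theorem Red.induction {motive : Term 0 → Prop} {N : Term 0} (refl : motive N)
    (step : ∀ M M', Step M 0 M' → Red M' N → motive M' → motive M) {M : Term 0} (h : Red M N) :
    motive M := by
  obtain ⟨h⟩ := h
  have key : ∀ {M N : Term 0} {k : ℕ} (_ : Steps M k N) (motive : Term 0 → Prop), k = 0 →
      motive N → (∀ M M', Step M 0 M' → Red M' N → motive M' → motive M) → motive M := by
    intro M N k h
    induction h with
    | refl M => exact fun _ _ h _ => h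
    | @step M M' N k m h t ih =>
      intro motive hk refl step
      obtain ⟨rfl, rfl⟩ : k = 0 ∧ m = 0 := by omega
      exact step M M' h ⟨t⟩ (ih motive rfl refl step)
  exact key h motive rfl refl step

theorem Red.refl (M : Term 0) : Red M M := ⟨.refl M⟩

theorem Red.head {M M' N : Term 0} (h : Step M 0 M') (t : Red M' N) : Red M N :=
  t.elim fun t => ⟨.step h t⟩

theorem Red.single {M N : Term 0} (h : Step M 0 N) : Red M N := .head h (.refl N)

theorem Red.trans {M N L : Term 0} (h : Red M N) (h' : Red N L) : Red M L :=
  Red.induction (motive := fun M => Red M L) h' (fun _ _ s _ ih => .head s ih) h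

theorem Red.plug (E : ECtx) {M N : Term 0} (h : Red M N) : Red (E.plug M) (E.plug N) :=
  Red.induction (motive := fun M => Red (E.plug M) (E.plug N)) (.refl _)
    (fun _ _ s _ ih => .head (.ctx E s) ih) h

theorem Red.unfolds {M N L : Term 0} (h : Red M N) (h' : Unfolds N L) : Unfolds M L :=
  h'.imp fun _ h' => ⟨h.trans h'.1, h'.2⟩

theorem Unfolds.plug (E : ECtx) {M N : Term 0} (h : Unfolds M N) :
    Unfolds (E.plug M) (E.plug N) := by
  obtain ⟨M', h, ⟨s⟩⟩ := h
  exact ⟨_, h.plug E, ⟨.ctx E s⟩⟩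

/-- The result of an unfold-fold reduction preceded by other reductions is determined. -/
theorem Unfolds.unique {M N N' : Term 0} (h : Unfolds M N) (h' : Unfolds M N') : N = N' := by
  obtain ⟨L, h, ⟨s⟩⟩ := h
  obtain ⟨L', h', ⟨s'⟩⟩ := h'
  -- A term that makes an unfold-fold reduction makes no other reduction.
  have aux : ∀ {L L' N N' : Term 0}, Step L 1 N → Step L' 1 N' → Red L L' → N = N' := by
    intro L L' N N' s s' r
    refine Red.induction (motive := fun L => Step L 1 N → N = N') (fun s => ?_)
      (fun L K t _ _ s => ?_) r s
    · have := s.next?_eq.symm.trans s'.next?_eq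
      simp_all
    · have := s.next?_eq.symm.trans t.next?_eq
      simp_all
  refine Red.induction (motive := fun M => Red M L' → N = N') (fun r => aux s s' r)
    (fun M K t r ih h' => ?_) h h'
  refine Red.induction (motive := fun M' => M' = M → N = N') ?_ (fun M' K' t' r' _ e => ?_) h' rfl
  · rintro rfl
    exact (aux s' s (.head t r)).symm
  · subst e
    have := t.next?_eq.symm.trans t'.next?_eq
    simp only [Option.some.injEq, Prod.mk.injEq, true_and] at this
    subst this
    exact ih r'

/-! ### The guarded transitive closure, stage by stage -/

theorem nonempty_GSteps_zero {n : ℕ} {M N : Term 0} :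
    Nonempty ((GSteps 0 M N).obj n) ↔ Red M N := Iff.rfl

theorem nonempty_GSteps_succ {k n : ℕ} {M N : Term 0} :
    Nonempty ((GSteps (k + 1) M N).obj n) ↔
      ∃ L, Unfolds M L ∧ Nonempty ((later (GSteps k L N)).obj n) := by
  constructor
  · rintro ⟨M', L, h, s, r⟩
    exact ⟨L, ⟨M', ⟨h⟩, ⟨s⟩⟩, ⟨r⟩⟩
  · rintro ⟨L, ⟨M', ⟨h⟩, ⟨s⟩⟩, ⟨r⟩⟩
    exact ⟨⟨M', L, h, s, r⟩⟩

/-- An object `P` maps to `M ⇒ᵏ N` as soon as `M ⇒ᵏ N` is inhabited at every stage at which `P` is.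
The terms and derivations can be chosen uniformly in the stage since reduction is deterministic. -/
theorem nonempty_hom_GSteps (k : ℕ) (M N : Term 0) (P : ToT.{0})
    (hP : ∀ n, P.obj n → Nonempty ((GSteps k M N).obj n)) : Nonempty (Hom P (GSteps k M N)) := by
  induction k generalizing M P with
  | zero =>
    by_cases h : Red M N
    · obtain ⟨h⟩ := h
      exact ⟨⟨fun _ _ => h, fun _ _ => rfl⟩⟩
    · exact ⟨⟨fun n x => (h (hP n x)).elim, fun n x => (h (hP (n + 1) x)).elim⟩⟩
  | succ k ih =>
    by_cases h : ∃ L, Unfolds M L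
    · obtain ⟨L, hL⟩ := h
      obtain ⟨M', ⟨r⟩, ⟨s⟩⟩ := id hL
      -- The `▷` in `M ⇒ᵏ⁺¹ N` shifts the stage, so the induction hypothesis is used for `P` shifted
      -- by one.
      obtain ⟨f⟩ := ih L ⟨fun n => P.obj (n + 1), fun n => P.res (n + 1)⟩ fun n x => by
        obtain ⟨L', hL', h⟩ := nonempty_GSteps_succ.1 (hP (n + 1) x)
        obtain rfl := hL.unique hL'
        exact h
      let g : Hom P (later (GSteps k L N)) :=
        { app := fun n => match n with
            | 0 => fun _ => PUnit.unit
            | n + 1 => f.app n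
          naturality := fun n => match n with
            | 0 => fun _ => rfl
            | n + 1 => f.naturality n }
      refine ⟨⟨fun n x => ⟨M', L, r, s, g.app n x⟩, fun n x => ?_⟩⟩
      exact congrArg (fun y => (⟨M', L, r, s, y⟩ : (GSteps (k + 1) M N).obj n)) (g.naturality n x)
    · have h' : ∀ n, P.obj n → False := fun n x =>
        h ((nonempty_GSteps_succ.1 (hP n x)).imp fun _ h => h.1)
      exact ⟨⟨fun n x => (h' n x).elim, fun n x => (h' (n + 1) x).elim⟩⟩

/-- Soundness of `M ⇒ᵏ N` at a single stage, when all derivations for `N` have the same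
interpretation `x`. -/
theorem GSteps_sound (k : ℕ) {M N : Term 0} {Γ : Fin 0 → Ty 0} {s : Ty 0} (d : HasType Γ M s)
    {x : Hom (Ctx Γ) s.den} (hN : ∀ e : HasType Γ N s, e.den = x) (n : ℕ)
    (h : Nonempty ((GSteps k M N).obj n)) (γ : (Ctx Γ).obj n) :
    d.den.app n γ = (x.comp (s.delay.iterate k)).app n γ := by
  induction k generalizing M n with
  | zero =>
    obtain ⟨h⟩ := h
    obtain ⟨e, he⟩ := Steps.denotes h d
    rw [he, hN e]
  | succ k ih =>
    obtain ⟨L, ⟨M', ⟨h⟩, ⟨t⟩⟩, hr⟩ := nonempty_GSteps_succ.1 h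
    obtain ⟨d', h'⟩ := Steps.denotes h d
    obtain ⟨e, he⟩ := Step.denotes t d'
    rw [h', he]
    cases n with
    -- At stage `0` the map `δ` is constant.
    | zero => rfl
    | succ n =>
      change s.tick.app (n + 1) (s.den.res n (e.den.app (n + 1) γ)) =
        s.tick.app (n + 1) (s.den.res n ((x.comp (s.delay.iterate k)).app (n + 1) γ))
      rw [e.den.naturality, (x.comp (s.delay.iterate k)).naturality, ih e n hr]

/-! ### Composition of substitutions -/

namespace Term

theorem lift_rename_apply {l m n : ℕ} (r : Fin l → Fin m) (σ : Fin m → Term n) (i : Fin (l + 1)) :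
    (Fin.cons (var 0) fun i => (σ i).rename Fin.succ : Fin (m + 1) → Term (n + 1))
        ((Fin.cons 0 fun i => (r i).succ : Fin (l + 1) → Fin (m + 1)) i) =
      (Fin.cons (var 0) fun i => (σ (r i)).rename Fin.succ : Fin (l + 1) → Term (n + 1)) i := by
  refine Fin.cases ?_ (fun i => ?_) i <;> rfl

theorem rename_rename {l m n : ℕ} (r : Fin l → Fin m) (r' : Fin m → Fin n) (M : Term l) :
    (M.rename r).rename r' = M.rename fun i => r' (r i) := by
  have lift : ∀ {l m n : ℕ} (r : Fin l → Fin m) (r' : Fin m → Fin n),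
      (fun i => (Fin.cons 0 fun i => (r' i).succ : Fin (m + 1) → Fin (n + 1))
        ((Fin.cons 0 fun i => (r i).succ : Fin (l + 1) → Fin (m + 1)) i)) =
      (Fin.cons 0 fun i => (r' (r i)).succ : Fin (l + 1) → Fin (n + 1)) := by
    intro l m n r r'
    funext i
    refine Fin.cases ?_ (fun i => ?_) i <;> rfl
  induction M generalizing m n <;> simp only [rename, *]

theorem rename_subst {l m n : ℕ} (r : Fin l → Fin m) (σ : Fin m → Term n) (M : Term l) :
    (M.rename r).subst σ = M.subst fun i => σ (r i) := by
  induction M generalizing m n <;> simp only [rename, subst, lift_rename_apply, *]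

theorem subst_rename {l m n : ℕ} (σ : Fin l → Term m) (r : Fin m → Fin n) (M : Term l) :
    (M.subst σ).rename r = M.subst fun i => (σ i).rename r := by
  have lift : ∀ {l m n : ℕ} (σ : Fin l → Term m) (r : Fin m → Fin n),
      (fun i => ((Fin.cons (var 0) fun i => (σ i).rename Fin.succ : Fin (l + 1) → Term (m + 1))
        i).rename (Fin.cons 0 fun i => (r i).succ)) =
      (Fin.cons (var 0) fun i => ((σ i).rename r).rename Fin.succ :
        Fin (l + 1) → Term (n + 1)) := by
    intro l m n σ r
    funext i
    refine Fin.cases ?_ (fun i => ?_) i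
    · rfl
    · exact Eq.trans (b := (σ i).rename fun j => (r j).succ) (rename_rename _ _ _)
        (rename_rename _ _ _).symm
  induction M generalizing m n <;> simp only [rename, subst, *]

theorem subst_subst {l m n : ℕ} (σ : Fin l → Term m) (τ : Fin m → Term n) (M : Term l) :
    (M.subst σ).subst τ = M.subst fun i => (σ i).subst τ := by
  have lift : ∀ {l m n : ℕ} (σ : Fin l → Term m) (τ : Fin m → Term n),
      (fun i => ((Fin.cons (var 0) fun i => (σ i).rename Fin.succ : Fin (l + 1) → Term (m + 1))
        i).subst (Fin.cons (var 0) fun i => (τ i).rename Fin.succ)) =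
      (Fin.cons (var 0) fun i => ((σ i).subst τ).rename Fin.succ :
        Fin (l + 1) → Term (n + 1)) := by
    intro l m n σ τ
    funext i
    refine Fin.cases ?_ (fun i => ?_) i
    · rfl
    · exact (rename_subst _ _ _).trans (subst_rename _ _ _).symm
  induction M generalizing m n <;> simp only [subst, *]

theorem subst_var {n : ℕ} (M : Term n) : M.subst var = M := by
  have lift : ∀ n : ℕ, (Fin.cons (var 0) fun i => ((var i : Term n)).rename Fin.succ :
      Fin (n + 1) → Term (n + 1)) = var := by
    intro n
    funext i
    refine Fin.cases ?_ (fun i => ?_) i <;> rfl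
  induction M <;> simp only [subst, *]

/-- Substituting below a binder and then for the bound variable is one simultaneous substitution. -/
theorem subst_inst {m n : ℕ} (M : Term (m + 1)) (σ : Fin m → Term n) (N : Term n) :
    (M.subst (Fin.cons (var 0) fun i => (σ i).rename Fin.succ)).inst N =
      M.subst (Fin.cons N σ) := by
  refine (subst_subst _ _ _).trans (congrArg (fun τ => subst τ M) ?_)
  funext i
  refine Fin.cases ?_ (fun i => ?_) i
  · rfl
  · exact (rename_subst _ _ _).trans (subst_var _)

end Term

/-! ### The logical relation -/

/-- A relation between elements of `X` and terms, at the stages before `n`, induces one between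
elements of `▷X` and terms at stage `n`. -/
def LaterRel {X : ToT.{0}} : (n : ℕ) → (∀ j, j < n → X.obj j → Term 0 → Prop) →
    (later X).obj n → Term 0 → Prop
  | 0, _, _, _ => True
  | n + 1, P, x, M => P n n.lt_succ_self x M

/-- An element of `▷X` is related to a term `M` with `M →*⁰ M' →¹ L` when it is related one step
later to `L`. -/
def TickRel {X : ToT.{0}} (n : ℕ) (P : ∀ j, j < n → X.obj j → Term 0 → Prop)
    (x : (later X).obj n) (M : Term 0) : Prop :=
  ∃ L, Unfolds M L ∧ LaterRel n P x L

/-- The extension of a relation from `A` to `LA`: each step of the lifting is matched by an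
unfold-fold reduction. At stage `0` nothing is known about the term after that reduction. -/
def LiftRel {A : ToT.{0}} : (n : ℕ) → (∀ j, j ≤ n → A.obj j → Term 0 → Prop) →
    (lift A).obj n → Term 0 → Prop
  | 0, P, .inl a, M => P 0 le_rfl a M
  | 0, _, .inr _, M => ∃ L, Unfolds M L ∧ True
  | n + 1, P, .inl a, M => P (n + 1) le_rfl a M
  | n + 1, P, .inr r, M =>
      ∃ L, Unfolds M L ∧ LiftRel n (fun j h => P j (h.trans n.le_succ)) r L

/-- The relation for a coproduct. -/
def SumRel {A B : ToT.{0}} {n : ℕ} (P : A.obj n → Term 0 → Prop) (Q : B.obj n → Term 0 → Prop) :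
    (ToT.sum A B).obj n → Term 0 → Prop
  | .inl a, M => ∃ L, Red M (.inl L) ∧ P a L
  | .inr b, M => ∃ L, Red M (.inr L) ∧ Q b L

theorem TickRel.of_red {X : ToT.{0}} {n : ℕ} {P : ∀ j, j < n → X.obj j → Term 0 → Prop}
    {x : (later X).obj n} {M M' : Term 0} (h : Red M M') (hx : TickRel n P x M') :
    TickRel n P x M :=
  hx.imp fun _ hx => ⟨h.unfolds hx.1, hx.2⟩

theorem TickRel.res {X : ToT.{0}} {n : ℕ} {P : ∀ j, X.obj j → Term 0 → Prop}
    (hP : ∀ j < n, ∀ x M, P (j + 1) x M → P j (X.res j x) M) {x : (later X).obj (n + 1)}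
    {M : Term 0} (h : TickRel (n + 1) (fun j _ => P j) x M) :
    TickRel n (fun j _ => P j) ((later X).res n x) M := by
  obtain ⟨L, hL, h⟩ := h
  refine ⟨L, hL, ?_⟩
  cases n with
  | zero => trivial
  | succ n => exact hP n n.lt_succ_self x L h

theorem LiftRel.of_red {A : ToT.{0}} {n : ℕ} {P : ∀ j, j ≤ n → A.obj j → Term 0 → Prop}
    {x : (lift A).obj n} {M M' : Term 0} (h : Red M M') (hx : LiftRel n P x M')
    (hP : ∀ a, P n le_rfl a M' → P n le_rfl a M) : LiftRel n P x M := by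
  cases n <;> rcases x with a | r
  · exact hP a hx
  · exact hx.imp fun _ hx => ⟨h.unfolds hx.1, hx.2⟩
  · exact hP a hx
  · exact hx.imp fun _ hx => ⟨h.unfolds hx.1, hx.2⟩

theorem LiftRel.res {A : ToT.{0}} {n : ℕ} {P : ∀ j, A.obj j → Term 0 → Prop}
    (hP : ∀ j ≤ n, ∀ a M, P (j + 1) a M → P j (A.res j a) M) {x : (lift A).obj (n + 1)}
    {M : Term 0} (h : LiftRel (n + 1) (fun j _ => P j) x M) :
    LiftRel n (fun j _ => P j) ((lift A).res n x) M := by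
  induction n generalizing M with
  | zero =>
    rcases x with a | r
    · exact hP 0 le_rfl a M h
    · exact h.imp fun _ h => ⟨h.1, trivial⟩
  | succ n ih =>
    rcases x with a | r
    · exact hP (n + 1) le_rfl a M h
    · exact h.imp fun _ h => ⟨h.1, ih (fun j hj => hP j (hj.trans n.le_succ)) h.2⟩

theorem liftRel_eta {A : ToT.{0}} {n : ℕ} {P : ∀ j, j ≤ n → A.obj j → Term 0 → Prop} {a : A.obj n}
    {M : Term 0} : LiftRel n P ((Hom.eta A).app n a) M ↔ P n le_rfl a M := by
  cases n <;> exact Iff.rfl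

theorem liftRel_liftTick {A : ToT.{0}} {n : ℕ} {P : ∀ j, A.obj j → Term 0 → Prop}
    {r : (later (lift A)).obj n} {M : Term 0} :
    LiftRel n (fun j _ => P j) ((Hom.liftTick A).app n r) M ↔
      TickRel n (fun j _ => LiftRel j fun i _ => P i) r M := by
  cases n <;> exact Iff.rfl

/-- The relation `x R_σ M` between elements of `⟦σ⟧` at stage `n` and closed terms. It is defined by
recursion on the stage and, at a fixed stage, on the type; the clause for `μ` refers to the larger
type `τ[μα.τ/α]`, but one step later. -/
def Rel : (n : ℕ) → (s : Ty 0) → s.den.obj n → Term 0 → Prop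
  | _, .var i => i.elim0
  | n, .one => fun x M =>
      LiftRel n (fun _ _ _ L => Red L .unit) ((Hom.ofEq Ty.den_one).app n x) M
  | n, .sum a b => fun x M =>
      LiftRel n (fun j _ => SumRel (Rel j a) (Rel j b)) ((Hom.ofEq (Ty.den_sum a b)).app n x) M
  | n, .prod a b => fun x M =>
      Rel n a ((Hom.ofEq (Ty.den_prod a b)).app n x).1 (.fst M) ∧
        Rel n b ((Hom.ofEq (Ty.den_prod a b)).app n x).2 (.snd M)
  | n, .arr a b => fun x M => ∀ j (h : j ≤ n) y N, Rel j a y N →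
      Rel j b (((Hom.ofEq (Ty.den_arr a b)).app n x).1 j h y) (.app M N)
  | n, .mu a => fun x M =>
      TickRel n (fun j _ => Rel j (a.inst (.mu a))) ((Hom.ofEq (Ty.den_mu a)).app n x) (.unfold M)
termination_by n s => (n, sizeOf s)
decreasing_by
  all_goals
    simp only [Prod.lex_def, Ty.sum.sizeOf_spec, Ty.prod.sizeOf_spec, Ty.arr.sizeOf_spec,
      lt_self_iff_false, true_and, false_or]
    omega

/-- The induction principle that goes with the recursive definition of `Rel`. -/
@[elab_as_elim]
theorem stageInduction {motive : ℕ → Ty 0 → Prop} (one : ∀ n, motive n .one)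
    (sum : ∀ n a b, (∀ j ≤ n, motive j a) → (∀ j ≤ n, motive j b) → motive n (.sum a b))
    (prod : ∀ n a b, motive n a → motive n b → motive n (.prod a b))
    (arr : ∀ n a b, (∀ j ≤ n, motive j a) → (∀ j ≤ n, motive j b) → motive n (.arr a b))
    (mu : ∀ n a, (∀ j < n, motive j (a.inst (.mu a))) → motive n (.mu a)) (n : ℕ) (s : Ty 0) :
    motive n s := by
  induction n using Nat.strong_induction_on generalizing s with
  | _ n ih =>
    have key : ∀ (k : ℕ) (a : Ty k) (hk : k = 0), motive n (hk ▸ a) := by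
      intro k a
      have below : ∀ {a : Ty 0}, motive n a → ∀ j ≤ n, motive j a := fun h j hj =>
        (Nat.lt_or_eq_of_le hj).elim (fun hj => ih j hj _) (fun e => e ▸ h)
      induction a with
      | var i => rintro rfl; exact i.elim0
      | one => rintro rfl; exact one n
      | sum a b iha ihb => rintro rfl; exact sum n a b (below (iha rfl)) (below (ihb rfl))
      | prod a b iha ihb => rintro rfl; exact prod n a b (iha rfl) (ihb rfl)
      | arr a b iha ihb => rintro rfl; exact arr n a b (below (iha rfl)) (below (ihb rfl))
      | mu a _ => rintro rfl; exact mu n a fun j hj => ih j hj _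
    exact key 0 s rfl

section

variable {n : ℕ} {a b : Ty 0} {M : Term 0}

theorem rel_one {x : (Ty.den .one).obj n} : Rel n .one x M ↔
    LiftRel n (fun _ _ _ L => Red L .unit) ((Hom.ofEq Ty.den_one).app n x) M := by
  rw [Rel]

theorem rel_sum {x : (Ty.sum a b).den.obj n} : Rel n (.sum a b) x M ↔
    LiftRel n (fun j _ => SumRel (Rel j a) (Rel j b)) ((Hom.ofEq (Ty.den_sum a b)).app n x) M := by
  rw [Rel]

theorem rel_prod {x : (Ty.prod a b).den.obj n} : Rel n (.prod a b) x M ↔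
    Rel n a ((Hom.ofEq (Ty.den_prod a b)).app n x).1 (.fst M) ∧
      Rel n b ((Hom.ofEq (Ty.den_prod a b)).app n x).2 (.snd M) := by
  rw [Rel]

theorem rel_arr {x : (Ty.arr a b).den.obj n} : Rel n (.arr a b) x M ↔
    ∀ j (h : j ≤ n) y N, Rel j a y N →
      Rel j b (((Hom.ofEq (Ty.den_arr a b)).app n x).1 j h y) (.app M N) := by
  rw [Rel]

theorem rel_mu {a : Ty 1} {x : (Ty.mu a).den.obj n} : Rel n (.mu a) x M ↔
    TickRel n (fun j _ => Rel j (a.inst (.mu a))) ((Hom.ofEq (Ty.den_mu a)).app n x)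
      (.unfold M) := by
  rw [Rel]

end

/-! ### Closure properties of the logical relation -/

theorem SumRel.of_red {A B : ToT.{0}} {n : ℕ} {P : A.obj n → Term 0 → Prop}
    {Q : B.obj n → Term 0 → Prop} {x : (ToT.sum A B).obj n} {M M' : Term 0} (h : Red M M')
    (hx : SumRel P Q x M') : SumRel P Q x M := by
  rcases x with a | b
  · exact hx.imp fun _ hx => ⟨h.trans hx.1, hx.2⟩
  · exact hx.imp fun _ hx => ⟨h.trans hx.1, hx.2⟩

/-- The relation is closed under expansion of the term by `→*⁰`. -/
theorem Rel.of_red {n : ℕ} {s : Ty 0} {x : s.den.obj n} {M M' : Term 0} (h : Red M M')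
    (hx : Rel n s x M') : Rel n s x M := by
  induction n, s using stageInduction generalizing M M' with
  | one n => exact rel_one.2 ((rel_one.1 hx).of_red h fun _ ha => h.trans ha)
  | sum n a b _ _ => exact rel_sum.2 ((rel_sum.1 hx).of_red h fun _ ha => ha.of_red h)
  | prod n a b iha ihb =>
    exact rel_prod.2 ⟨iha (h.plug (.fst .hole)) (rel_prod.1 hx).1,
      ihb (h.plug (.snd .hole)) (rel_prod.1 hx).2⟩
  | arr n a b _ ihb =>
    exact rel_arr.2 fun j hj y N hy =>
      ihb j hj (h.plug (.app .hole N)) (rel_arr.1 hx j hj y N hy)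
  | mu n a _ => exact rel_mu.2 ((rel_mu.1 hx).of_red (h.plug (.unfold .hole)))

/-- The relation is stable under restriction to an earlier stage. -/
theorem Rel.res {n : ℕ} {s : Ty 0} {x : s.den.obj (n + 1)} {M : Term 0}
    (hx : Rel (n + 1) s x M) : Rel n s (s.den.res n x) M := by
  induction n, s using stageInduction generalizing M with
  | one n =>
    rw [rel_one, ← Hom.naturality]
    exact (rel_one.1 hx).res (P := fun _ _ L => Red L .unit) fun _ _ _ _ h => h
  | sum n a b iha ihb =>
    rw [rel_sum, ← Hom.naturality]
    refine (rel_sum.1 hx).res (P := fun j => SumRel (Rel j a) (Rel j b)) fun j hj y L h => ?_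
    rcases y with y | y
    · exact h.imp fun _ h => ⟨h.1, iha j hj h.2⟩
    · exact h.imp fun _ h => ⟨h.1, ihb j hj h.2⟩
  | prod n a b iha ihb =>
    rw [rel_prod, ← Hom.naturality]
    exact ⟨iha (rel_prod.1 hx).1, ihb (rel_prod.1 hx).2⟩
  | arr n a b _ _ =>
    rw [rel_arr, ← Hom.naturality]
    exact fun j hj => rel_arr.1 hx j (hj.trans n.le_succ)
  | mu n a ih =>
    rw [rel_mu, ← Hom.naturality]
    exact (rel_mu.1 hx).res fun j hj x M h => ih j hj h

theorem Rel.down {n j : ℕ} (hj : j ≤ n) {s : Ty 0} {x : s.den.obj n} {M : Term 0}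
    (hx : Rel n s x M) : Rel j s (s.den.down hj x) M := by
  induction n with
  | zero =>
    obtain rfl : j = 0 := by omega
    rwa [down_self]
  | succ n ih =>
    rcases Nat.lt_or_ge n j with h | h
    · obtain rfl : j = n + 1 := by omega
      rwa [down_self]
    · rw [down_succ _ h]
      exact ih h hx.res

/-- The relation is compatible with the algebra structures: a term that makes one unfold-fold
reduction is related to a delayed element. -/
theorem Rel.tick {n : ℕ} {s : Ty 0} {x : (later s.den).obj n} {M : Term 0}
    (hx : TickRel n (fun j _ => Rel j s) x M) : Rel n s (s.tick.app n x) M := by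
  induction n, s using stageInduction generalizing M with
  | one n =>
    rw [rel_one, Ty.tick_one]
    simp only [Hom.comp, Hom.ofEq_ofEq_symm]
    refine (liftRel_liftTick (P := fun _ _ L => Red L .unit)).2 ?_
    obtain ⟨L, hL, h⟩ := hx
    refine ⟨L, hL, ?_⟩
    cases n with
    | zero => trivial
    | succ n => exact rel_one.1 h
  | sum n a b _ _ =>
    rw [rel_sum, Ty.tick_sum]
    simp only [Hom.comp, Hom.ofEq_ofEq_symm]
    refine (liftRel_liftTick (P := fun j => SumRel (Rel j a) (Rel j b))).2 ?_
    obtain ⟨L, hL, h⟩ := hx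
    refine ⟨L, hL, ?_⟩
    cases n with
    | zero => trivial
    | succ n => exact rel_sum.1 h
  | prod n a b iha ihb =>
    rw [rel_prod, Ty.tick_prod]
    obtain ⟨L, hL, h⟩ := hx
    have e : ∀ y : (ToT.prod a.den b.den).obj n, (Hom.ofEq (Ty.den_prod a b)).app n
      ((Hom.ofEq (Ty.den_prod a b).symm).app n y) = y := Hom.ofEq_ofEq_symm _ n
    change Rel n a ((Hom.ofEq (Ty.den_prod a b)).app n
        ((Hom.ofEq (Ty.den_prod a b).symm).app n _)).1 _ ∧
      Rel n b ((Hom.ofEq (Ty.den_prod a b)).app n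
        ((Hom.ofEq (Ty.den_prod a b).symm).app n _)).2 _
    rw [e]
    refine ⟨iha ⟨.fst L, hL.plug (.fst .hole), ?_⟩, ihb ⟨.snd L, hL.plug (.snd .hole), ?_⟩⟩
    · cases n with
      | zero => trivial
      | succ n => exact (rel_prod.1 h).1
    · cases n with
      | zero => trivial
      | succ n => exact (rel_prod.1 h).2
  | arr n a b _ ihb =>
    rw [rel_arr, Ty.tick_arr]
    obtain ⟨L, hL, h⟩ := hx
    intro j hj y N hy
    simp only [Hom.comp, Hom.ofEq_ofEq_symm]
    refine ihb j hj ⟨.app L N, hL.plug (.app .hole N), ?_⟩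
    cases j with
    | zero => trivial
    | succ j =>
      cases n with
      | zero => omega
      | succ n =>
        have hj' : j ≤ n := Nat.le_of_succ_le_succ hj
        have := rel_arr.1 (Rel.down hj' h) j le_rfl _ N hy.res
        have e : ((later (Ty.arr a b).den).down hj x : (Ty.arr a b).den.obj j) =
          (Ty.arr a b).den.down hj' x := down_later_succ (Ty.arr a b).den hj' hj x
        exact (congrArg (fun z : (Ty.arr a b).den.obj j => Rel j b
          (((Hom.ofEq (Ty.den_arr a b)).app j z).1 j le_rfl (a.den.res j y)) (.app L N))
          e).mpr this
  | mu n a ih =>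
    rw [rel_mu, Ty.tick_mu]
    obtain ⟨L, hL, h⟩ := hx
    simp only [Hom.comp, Hom.ofEq_ofEq_symm]
    refine ⟨.unfold L, hL.plug (.unfold .hole), ?_⟩
    cases n with
    | zero => trivial
    | succ n => exact ih n n.lt_succ_self (rel_mu.1 h)

/-- The relation is compatible with case distinction. -/
theorem rel_extend {G A B : ToT.{0}} {s : Ty 0} {P : ∀ n, A.obj n → Term 0 → Prop}
    {Q : ∀ n, B.obj n → Term 0 → Prop} (f : Hom (ToT.prod G (ToT.sum A B)) s.den) {K K' : Term 1}
    (n : ℕ) (g : G.obj n) (x : (lift (ToT.sum A B)).obj n) (L : Term 0)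
    (hf : ∀ j (hj : j ≤ n) a N, P j a N → Rel j s (f.app j (G.down hj g, .inl a)) (K.inst N))
    (hf' : ∀ j (hj : j ≤ n) b N, Q j b N → Rel j s (f.app j (G.down hj g, .inr b)) (K'.inst N))
    (hx : LiftRel n (fun j _ => SumRel (P j) (Q j)) x L) :
    Rel n s ((Hom.extend s.tick f).app n (g, x)) (.case L K K') := by
  -- The case of a value `η(inl a)` or `η(inr b)`, which occurs at every stage.
  have base : ∀ (n : ℕ) (g : G.obj n) (x : (ToT.sum A B).obj n) (L : Term 0),
      (∀ j (hj : j ≤ n) a N, P j a N → Rel j s (f.app j (G.down hj g, .inl a)) (K.inst N)) →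
      (∀ j (hj : j ≤ n) b N, Q j b N → Rel j s (f.app j (G.down hj g, .inr b)) (K'.inst N)) →
      SumRel (P n) (Q n) x L → Rel n s (f.app n (g, x)) (.case L K K') := by
    intro n g x L hf hf' hx
    rcases x with a | b
    · obtain ⟨N, hN, h⟩ := hx
      have := hf n le_rfl a N h
      rw [down_self] at this
      exact this.of_red ((hN.plug (.case .hole K K')).trans (.single (.case_inl N K K')))
    · obtain ⟨N, hN, h⟩ := hx
      have := hf' n le_rfl b N h
      rw [down_self] at this
      exact this.of_red ((hN.plug (.case .hole K K')).trans (.single (.case_inr N K K')))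
  induction n generalizing L with
  | zero =>
    rcases x with x | r
    · exact base 0 g x L hf hf' hx
    · obtain ⟨N, hN, -⟩ := hx
      exact Rel.tick (n := 0) ⟨_, hN.plug (.case .hole K K'), trivial⟩
  | succ n ih =>
    rcases x with x | r
    · exact base (n + 1) g x L hf hf' hx
    · obtain ⟨N, hN, h⟩ := hx
      refine Rel.tick (n := n + 1) ⟨_, hN.plug (.case .hole K K'), ?_⟩
      refine ih (G.res n g) r N (fun j hj a N' h => ?_) (fun j hj b N' h => ?_) h
      · rw [← down_succ G hj (hj.trans n.le_succ)]
        exact hf j _ a N' h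
      · rw [← down_succ G hj (hj.trans n.le_succ)]
        exact hf' j _ b N' h

/-! ### The fundamental lemma and adequacy -/

/-- The fundamental lemma of the logical relation: a typed term, closed off by related terms, is
related to its interpretation. -/
theorem HasType.rel {m : ℕ} {Γ : Fin m → Ty 0} {M : Term m} {s : Ty 0} (d : HasType Γ M s)
    (n : ℕ) (γ : (Ctx Γ).obj n) (σ : Fin m → Term 0) (hσ : ∀ i, Rel n (Γ i) (γ i) (σ i)) :
    Rel n s (d.den.app n γ) (M.subst σ) := by
  have extend : ∀ {m : ℕ} {Γ : Fin m → Ty 0} {t : Ty 0} {n : ℕ} {γ : (Ctx Γ).obj n}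
      {σ : Fin m → Term 0}, (∀ i, Rel n (Γ i) (γ i) (σ i)) → ∀ {j : ℕ} (hj : j ≤ n)
      {y : t.den.obj j} {N : Term 0}, Rel j t y N → ∀ i,
      Rel j ((Fin.cons t Γ : Fin (m + 1) → Ty 0) i)
        ((Ctx.cons Γ t).app j ((Ctx Γ).down hj γ, y) i)
        ((Fin.cons N σ : Fin (m + 1) → Term 0) i) := by
    intro m Γ t n γ σ hσ j hj y N hy i
    refine Fin.cases hy (fun i => ?_) i
    have := (hσ i).down hj
    rw [← down_pi (fun i => (Γ i).den)] at this
    exact this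
  induction d generalizing n with
  | var i => exact hσ i
  | unit =>
    refine rel_one.2 ?_
    simp only [HasType.den, Hom.comp, Hom.ofEq_ofEq_symm]
    exact liftRel_eta.2 (.refl _)
  | @lam _ Γ s t M d ih =>
    refine rel_arr.2 fun j hj y N hy => ?_
    simp only [HasType.den, Hom.comp, Hom.ofEq_ofEq_symm]
    have := ih j _ _ (extend hσ hj hy)
    rw [← Term.subst_inst] at this
    exact this.of_red (.single (.beta _ _ _))
  | app d e ihd ihe => exact rel_arr.1 (ihd n γ σ hσ) n le_rfl _ _ (ihe n γ σ hσ)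
  | inl d ih =>
    refine rel_sum.2 ?_
    simp only [HasType.den, Hom.comp, Hom.ofEq_ofEq_symm]
    exact liftRel_eta.2 ⟨_, .refl _, ih n γ σ hσ⟩
  | inr d ih =>
    refine rel_sum.2 ?_
    simp only [HasType.den, Hom.comp, Hom.ofEq_ofEq_symm]
    exact liftRel_eta.2 ⟨_, .refl _, ih n γ σ hσ⟩
  | @case _ Γ s t u L M N d e f ihd ihe ihf =>
    refine rel_extend _ n γ _ _ (fun j hj a K h => ?_) (fun j hj b K h => ?_)
      (rel_sum.1 (ihd n γ σ hσ))
    · rw [Term.subst_inst]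
      exact ihe j _ _ (extend hσ hj h)
    · rw [Term.subst_inst]
      exact ihf j _ _ (extend hσ hj h)
  | fst d ih => exact (rel_prod.1 (ih n γ σ hσ)).1
  | snd d ih => exact (rel_prod.1 (ih n γ σ hσ)).2
  | pair d e ihd ihe =>
    refine rel_prod.2 ?_
    simp only [HasType.den, Hom.comp, Hom.ofEq_ofEq_symm]
    exact ⟨(ihd n γ σ hσ).of_red (.single (.fst_pair _ _)),
      (ihe n γ σ hσ).of_red (.single (.snd_pair _ _))⟩
  | unfold d ih => exact Rel.tick (rel_mu.1 (ih n γ σ hσ))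
  | fold d ih =>
    refine rel_mu.2 ?_
    simp only [HasType.den, Hom.comp, Hom.ofEq_ofEq_symm]
    refine ⟨_, ⟨_, .refl _, ⟨.unfold_fold _⟩⟩, ?_⟩
    cases n with
    | zero => trivial
    | succ n => exact (ih (n + 1) γ σ hσ).res

/-- A closed term related to `δᵏ(η(*))` makes `k` guarded unfold-fold reductions and then reaches `⟨⟩`,
as far as this is visible at stage `n`. -/
theorem nonempty_GSteps_of_rel (k n : ℕ) (M : Term 0)
    (h : Rel n .one ((etaStar.comp ((Ty.delay .one).iterate k)).app n PUnit.unit) M) :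
    Nonempty ((GSteps k M .unit).obj n) := by
  induction k generalizing n M with
  | zero =>
    refine nonempty_GSteps_zero.2 ?_
    have h := rel_one.1 h
    simp only [etaStar, Hom.iterate, Hom.comp_id] at h
    simp only [Hom.comp, Hom.ofEq_ofEq_symm] at h
    exact liftRel_eta.1 h
  | succ k ih =>
    have h := rel_one.1 h
    change LiftRel n (fun _ _ _ L => Red L .unit) ((Hom.ofEq Ty.den_one).app n
      ((Ty.tick .one).app n ((Hom.next _).app n
        ((etaStar.comp ((Ty.delay .one).iterate k)).app n PUnit.unit)))) M at h
    rw [Ty.tick_one] at h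
    simp only [Hom.comp, Hom.ofEq_ofEq_symm] at h
    obtain ⟨L, hL, h⟩ := (liftRel_liftTick (P := fun _ _ L => Red L .unit)).1 h
    refine nonempty_GSteps_succ.2 ⟨L, hL, ?_⟩
    cases n with
    | zero => exact ⟨PUnit.unit⟩
    | succ n =>
      refine ih n L (rel_one.2 ?_)
      exact (congrArg (fun z => LiftRel n (fun _ _ _ L => Red L .unit)
        ((Hom.ofEq Ty.den_one).app n z) L)
        ((etaStar.comp ((Ty.delay .one).iterate k)).naturality n PUnit.unit)).mp h

end FPC

theorem mainTheorem1 (M : FPC.Term 0) (d : FPC.HasType Fin.elim0 M FPC.Ty.one) (k : ℕ) :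
    Nonempty (ToT.Hom (FPC.GSteps k M FPC.Term.unit)
      (ToT.Id (FPC.Ctx.star.comp d.den) (FPC.etaStar.comp ((FPC.Ty.delay .one).iterate k)))) ∧
    Nonempty (ToT.Hom
      (ToT.Id (FPC.Ctx.star.comp d.den) (FPC.etaStar.comp ((FPC.Ty.delay .one).iterate k)))
      (FPC.GSteps k M FPC.Term.unit)) := by
  constructor
  · refine ⟨⟨fun n h => ⟨?_⟩, fun n h => rfl⟩⟩
    refine FPC.GSteps_sound k d (x := (ToT.Hom.toOne _).comp FPC.etaStar) (fun e => ?_) n ⟨h⟩ _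
    -- The only derivation of `⊢ ⟨⟩ : 1` is the axiom.
    cases e
    rfl
  · refine FPC.nonempty_hom_GSteps k M .unit _ fun n h => ?_
    refine FPC.nonempty_GSteps_of_rel k n M ?_
    have := d.rel n (FPC.Ctx.star.app n PUnit.unit) Fin.elim0 fun i => i.elim0
    rw [funext fun i : Fin 0 => (i.elim0 : Fin.elim0 i = FPC.Term.var i),
      FPC.Term.subst_var] at this
    rw [← h.down]
    exact this
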